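/- Let $M$ be a connected smooth $n$-dimensional manifold with a smooth (positive definite) Riemannian metric $g$, Levi-Civita connection $\nabla$ and Ricci tensor $\mathsf{Ri}_{jk}=R^i_{\,ijk}$, where $R(\partial_i,\partial_j)\partial_k=R^l_{\,ijk}\,\partial_l$ and $R(X,Y)Z=\nabla_X\nabla_YZ-\nabla_Y\nabla_XZ-\nabla_{[X,Y]}Z$. Indices after a semicolon denote covariant derivatives. Assume that $\mathsf{Ri}$ is not identically zero. Call a smooth one form nonzero if it is not identically zero on $M$. The Ricci tensor is called - Ricci recurrent if there is a nonzero smooth one form $\beta$ on $M$ such that $\mathsf{Ri}_{ij;\ell}=\beta_\ell\,\mathsf{Ri}_{ij}$; - pseudo Ricci symmetric if there is a nonzero smooth one form $\alpha$ on $M$ such that $\mathsf{Ri}_{ij;\ell}=2\alpha_\ell\,\mathsf{Ri}_{ij}+\alpha_i\,\mathsf{Ri}_{\ell j}+\alpha_j\,\mathsf{Ri}_{i\ell}$; - parallel if $\mathsf{Ri}_{ij;\ell}=0$. Then: (i) $\mathsf{Ri}$ is not both Ricci recurrent and pseudo Ricci symmetric. (ii) If $\mathsf{Ri}$ is parallel,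 then $\mathsf{Ri}$ is not pseudo Ricci symmetric. -/

import Mathlib

open scoped Manifold ContDiff
open Bundle

noncomputable section

namespace RicciClasses

/-- The model space `ℝⁿ`. -/
abbrev Model (n : ℕ) : Type := EuclideanSpace ℝ (Fin n)

/-! ### Coordinate expressions on (an open subset of) `ℝⁿ`

Here `G y` is the matrix `(g_{ij}(y))` of a metric in local coordinates. -/

section Local

variable {n : ℕ}

/-- The partial derivative `∂_i f` at `y`. -/
def partialD (i : Fin n) (f : Model n → ℝ) (y : Model n) : ℝ :=
  fderiv ℝ f y (EuclideanSpace.single i 1)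

/-- Christoffel symbols
`Γ^k_{ij} = ½ g^{kl} (∂_i g_{jl} + ∂_j g_{il} - ∂_l g_{ij})`. -/
def christoffel (G : Model n → Matrix (Fin n) (Fin n) ℝ) (k i j : Fin n) (y : Model n) : ℝ :=
  (1 / 2) * ∑ l, (G y)⁻¹ k l *
    (partialD i (fun z => G z j l) y + partialD j (fun z => G z i l) y
      - partialD l (fun z => G z i j) y)

/-- Components `R^l_{ijk}` of the curvature tensor, `R(∂_i, ∂_j) ∂_k = R^l_{ijk} ∂_l`, where
`R(X, Y) Z = ∇_X ∇_Y Z - ∇_Y ∇_X Z - ∇_{[X, Y]} Z`. -/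
def curvature (G : Model n → Matrix (Fin n) (Fin n) ℝ) (l i j k : Fin n) (y : Model n) : ℝ :=
  partialD i (christoffel G l j k) y - partialD j (christoffel G l i k) y
    + ∑ p, (christoffel G l i p y * christoffel G p j k y
      - christoffel G l j p y * christoffel G p i k y)

/-- Components `Ri_{jk} = R^i_{ijk}` of the Ricci tensor. -/
def ricci (G : Model n → Matrix (Fin n) (Fin n) ℝ) (j k : Fin n) (y : Model n) : ℝ :=
  ∑ i, curvature G i i j k y

/-- Components `Ri_{ij;l}` of the covariant derivative of the Ricci tensor. -/
def covRicci (G : Model n → Matrix (Fin n) (Fin n) ℝ) (i j l : Fin n) (y : Model n) : ℝ :=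
  partialD l (ricci G i j) y
    - ∑ p, (christoffel G p l i y * ricci G p j y + christoffel G p l j y * ricci G i p y)

end Local

/-! ### Riemannian manifolds -/

section Global

variable {n : ℕ} {M : Type*} [TopologicalSpace M] [ChartedSpace (Model n) M]

/-- The coordinate vector `∂_i` at the point `e.symm y` of the chart `e`. -/
def coordVec (e : OpenPartialHomeomorph M (Model n)) (i : Fin n) (y : Model n) :
    TangentSpace (𝓡 n) (e.symm y) :=
  mfderiv (𝓡 n) (𝓡 n) e.symm y (EuclideanSpace.single i (1 : ℝ) : Model n)

variable [IsManifold (𝓡 n) ∞ M]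

variable (n M) in
/-- Smooth (positive definite) Riemannian metrics on `M`. -/
abbrev Metric : Type _ :=
  ContMDiffRiemannianMetric (𝓡 n) ∞ (Model n) (fun x : M => TangentSpace (𝓡 n) x)

variable (n M) in
/-- Smooth one forms on `M`, that is, smooth sections of the cotangent bundle. -/
abbrev OneForm : Type _ :=
  ContMDiffSection (𝓡 n) (Model n →L[ℝ] ℝ) ∞ (fun x : M => TangentSpace (𝓡 n) x →L[ℝ] ℝ)

/-- The matrix `g_{ij}` of the metric in the chart `e`. -/
def Metric.coeff (g : Metric n M) (e : OpenPartialHomeomorph M (Model n)) (y : Model n) :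
    Matrix (Fin n) (Fin n) ℝ :=
  Matrix.of fun i j => g.inner (e.symm y) (coordVec e i y) (coordVec e j y)

/-- The component `α_i` of a one form in the chart `e`. -/
def OneForm.coeff (α : OneForm n M) (e : OpenPartialHomeomorph M (Model n)) (i : Fin n)
    (y : Model n) : ℝ :=
  α (e.symm y) (coordVec e i y)

/-- `Ri ≠ 0`: the Ricci tensor does not vanish identically. -/
def RicciNonzero (g : Metric n M) : Prop :=
  ∃ e ∈ atlas (Model n) M, ∃ y ∈ e.target, ∃ i j, ricci (Metric.coeff g e) i j y ≠ 0

/-- The Ricci tensor is parallel: `∇ Ri = 0`. -/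
def RicciParallel (g : Metric n M) : Prop :=
  ∀ e ∈ atlas (Model n) M, ∀ y ∈ e.target, ∀ i j l, covRicci (Metric.coeff g e) i j l y = 0

/-- Ricci recurrent: `Ri_{ij;l} = β_l Ri_{ij}` for some nonzero one form `β`. -/
def RicciRecurrent (g : Metric n M) : Prop :=
  ∃ β : OneForm n M, β ≠ 0 ∧
    ∀ e ∈ atlas (Model n) M, ∀ y ∈ e.target, ∀ i j l,
      covRicci (Metric.coeff g e) i j l y = OneForm.coeff β e l y * ricci (Metric.coeff g e) i j y

/-- Pseudo Ricci symmetric: `Ri_{ij;l} = 2 α_l Ri_{ij} + α_i Ri_{lj} + α_j Ri_{il}` for some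
nonzero one form `α`. -/
def PseudoRicciSymmetric (g : Metric n M) : Prop :=
  ∃ α : OneForm n M, α ≠ 0 ∧
    ∀ e ∈ atlas (Model n) M, ∀ y ∈ e.target, ∀ i j l,
      covRicci (Metric.coeff g e) i j l y =
        2 * OneForm.coeff α e l y * ricci (Metric.coeff g e) i j y
          + OneForm.coeff α e i y * ricci (Metric.coeff g e) l j y
          + OneForm.coeff α e j y * ricci (Metric.coeff g e) i l y

end Global

end RicciClasses

end

/-! Both parts rest on two facts. First, if `Ri` is pseudo Ricci symmetric, the defining equation
solved for `∂_l Ri_{ij}` is a linear first order system, so by Gronwall `Ri` vanishes near each of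
its zeros. As `M` is connected and `Ri ≢ 0`, it vanishes nowhere (`exists_ricci_ne_zero`). Second,
the symmetric product of a nonzero one form and a nonzero symmetric form is nonzero
(`eq_zero_of_cyclic_sum_eq_zero`).

For (ii), the cyclic sum of the pseudo symmetry equation with `∇ Ri = 0` says that the symmetric
product of `α` and `Ri` is zero, so `α = 0` everywhere.

For (i), the same cyclic sum gives `β = 4α`. Exchanging indices then gives `α_l Ri_{ij} = α_i
Ri_{lj}`, so `Ri` is a nonzero multiple of `α ⊗ α` on the open set where `α ≠ 0`. There some
diagonal entry `Ri_{aa}` is nonzero, and the vector field `v` dual to `Ri(∂_a, ·)` satisfies `∇v = θ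
⊗ v` for a one form `θ`. The Ricci identity reads `R(X, Y)v = dθ(X, Y) v`; putting `Y = v` and
tracing over `X` gives `Ri(v, v) = dθ(v, v) = 0`. But rank one gives `Ri_{aa} Ri(v, v) = g(v, v)² >
0`, a contradiction (`false_of_recurrent_of_rank_one`).

Most of the remaining work derives, from the coordinate formulas, the symmetry of `Ri` and the
independence of its vanishing from the chart. -/

noncomputable section

namespace RicciClasses

/-! ### Partial derivatives on `ℝⁿ`. -/

section Calculus

variable {n : ℕ}

/-- The basis vectors of `ℝⁿ`. -/
abbrev basisVec (i : Fin n) : Model n := EuclideanSpace.single i 1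

theorem sum_smul_basisVec (X : Model n) : ∑ i, X i • basisVec i = X := by
  ext k
  simp [Pi.single_apply]

theorem IsLinearMap.eq_of_basisVec {F : Type*} [AddCommGroup F] [Module ℝ F] {f g : Model n → F}
    (hf : IsLinearMap ℝ f) (hg : IsLinearMap ℝ g)
    (h : ∀ i, f (basisVec i) = g (basisVec i)) (X : Model n) : f X = g X := by
  have : hf.mk' f = hg.mk' g :=
    (EuclideanSpace.basisFun (Fin n) ℝ).toBasis.ext (fun i => by simpa using h i)
  exact LinearMap.congr_fun this X

theorem partialD_mul {f g : Model n → ℝ} {y : Model n} (i : Fin n)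
    (hf : DifferentiableAt ℝ f y) (hg : DifferentiableAt ℝ g y) :
    partialD i (fun z => f z * g z) y = partialD i f y * g y + f y * partialD i g y := by
  simp only [partialD]
  rw [fderiv_fun_mul hf hg]
  simp
  ring

theorem partialD_sum {ι : Type*} {s : Finset ι} {f : ι → Model n → ℝ} {y : Model n} (i : Fin n)
    (hf : ∀ a ∈ s, DifferentiableAt ℝ (f a) y) :
    partialD i (fun z => ∑ a ∈ s, f a z) y = ∑ a ∈ s, partialD i (f a) y := by
  simp only [partialD]
  rw [fderiv_fun_sum hf]
  simp

theorem partialD_congr {f g : Model n → ℝ} {y : Model n} (i : Fin n) (h : f =ᶠ[nhds y] g) :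
    partialD i f y = partialD i g y := by
  simp only [partialD, h.fderiv_eq]

theorem contDiffAt_partialD {f : Model n → ℝ} {y : Model n} (i : Fin n)
    (hf : ContDiffAt ℝ ∞ f y) : ContDiffAt ℝ ∞ (partialD i f) y :=
  (hf.fderiv_right (m := ∞) (by simp)).clm_apply contDiffAt_const

theorem partialD_comm {f : Model n → ℝ} {y : Model n} (i j : Fin n)
    (hf : ContDiffAt ℝ ∞ f y) : partialD i (partialD j f) y = partialD j (partialD i f) y := by
  have h1 : DifferentiableAt ℝ (fderiv ℝ f) y :=
    (hf.fderiv_right (m := ∞) (by simp)).differentiableAt (by simp)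
  have key (a b : Fin n) :
      partialD a (partialD b f) y = fderiv ℝ (fderiv ℝ f) y (basisVec a) (basisVec b) := by
    change fderiv ℝ (fun z => fderiv ℝ f z (basisVec b)) y (basisVec a) = _
    rw [fderiv_clm_apply h1 (by fun_prop)]
    simp
  rw [key, key]
  exact (hf.isSymmSndFDerivAt (by simpa using WithTop.coe_le_coe.2 (le_top : (2 : ℕ∞) ≤ ⊤))).eq _ _

end Calculus

/-! ### Metrics in coordinates: smoothness, Christoffel symbols, symmetry of the Ricci tensor. -/

section LocalMetric

variable {n : ℕ}

/-- `G` is the matrix of a smooth Riemannian metric on the open set `U`. -/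
structure IsMetricOn (G : Model n → Matrix (Fin n) (Fin n) ℝ) (U : Set (Model n)) : Prop where
  isOpen : IsOpen U
  contDiffAt : ∀ y ∈ U, ∀ i j, ContDiffAt ℝ ∞ (fun z => G z i j) y
  posDef : ∀ y ∈ U, (G y).PosDef

namespace IsMetricOn

variable {G : Model n → Matrix (Fin n) (Fin n) ℝ} {U : Set (Model n)} (hG : IsMetricOn G U)
  {y : Model n}
include hG

theorem symm (hy : y ∈ U) (i j : Fin n) : G y i j = G y j i := by
  simpa using ((hG.posDef y hy).1.apply i j).symm

theorem eventually_mem (hy : y ∈ U) : ∀ᶠ z in nhds y, z ∈ U := hG.isOpen.mem_nhds hy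

theorem isUnit_det (hy : y ∈ U) : IsUnit (G y).det := (hG.posDef y hy).det_pos.ne'.isUnit

theorem partialD_symm (hy : y ∈ U) (k i j : Fin n) :
    partialD k (fun z => G z i j) y = partialD k (fun z => G z j i) y :=
  partialD_congr k (by filter_upwards [hG.eventually_mem hy] with z hz using hG.symm hz i j)

/-- By Cramer's rule: the entries of the adjugate are determinants, hence polynomials in the entries
of `G`. -/
theorem contDiffAt_inv (hy : y ∈ U) (i j : Fin n) :
    ContDiffAt ℝ ∞ (fun z => (G z)⁻¹ i j) y := by
  have hdet : ∀ H : Model n → Matrix (Fin n) (Fin n) ℝ,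
      (∀ i j, ContDiffAt ℝ ∞ (fun z => H z i j) y) → ContDiffAt ℝ ∞ (fun z => (H z).det) y := by
    intro H hH
    simp only [Matrix.det_apply']
    exact ContDiffAt.sum fun σ _ => contDiffAt_const.mul (contDiffAt_prod fun k _ => hH _ _)
  have hadj : ContDiffAt ℝ ∞ (fun z => (G z).adjugate i j) y := by
    simp only [Matrix.adjugate_apply]
    refine hdet _ fun a b => ?_
    by_cases h : a = j
    · subst h
      simp only [Matrix.updateRow_self]
      exact contDiffAt_const
    · simp only [Matrix.updateRow_ne h]
      exact hG.contDiffAt y hy a b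
  have := ((hdet G (hG.contDiffAt y hy)).inv (hG.isUnit_det hy).ne_zero).mul hadj
  simpa [Matrix.inv_def, Matrix.smul_apply] using this

theorem contDiffAt_christoffel (hy : y ∈ U) (k i j : Fin n) :
    ContDiffAt ℝ ∞ (christoffel G k i j) y := by
  have h := hG.contDiffAt y hy
  unfold christoffel
  exact contDiffAt_const.mul (ContDiffAt.sum fun l _ => (hG.contDiffAt_inv hy k l).mul
    (((contDiffAt_partialD i (h j l)).add (contDiffAt_partialD j (h i l))).sub
      (contDiffAt_partialD l (h i j))))

theorem contDiffAt_curvature (hy : y ∈ U) (l i j k : Fin n) :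
    ContDiffAt ℝ ∞ (curvature G l i j k) y := by
  have h := hG.contDiffAt_christoffel hy
  unfold curvature
  exact ((contDiffAt_partialD _ (h _ _ _)).sub (contDiffAt_partialD _ (h _ _ _))).add
    (ContDiffAt.sum fun p _ => ((h _ _ _).mul (h _ _ _)).sub ((h _ _ _).mul (h _ _ _)))

theorem contDiffAt_ricci (hy : y ∈ U) (j k : Fin n) : ContDiffAt ℝ ∞ (ricci G j k) y := by
  unfold ricci
  exact ContDiffAt.sum fun i _ => hG.contDiffAt_curvature hy i i j k

theorem christoffel_symm (hy : y ∈ U) (k i j : Fin n) :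
    christoffel G k i j y = christoffel G k j i y := by
  simp only [christoffel]
  congr 1
  refine Finset.sum_congr rfl fun l _ => ?_
  rw [hG.partialD_symm hy l i j]
  ring

/-- The Christoffel symbols of the first kind. -/
theorem sum_mul_christoffel (hy : y ∈ U) (m i j : Fin n) :
    ∑ k, G y m k * christoffel G k i j y =
      (1 / 2) * (partialD i (fun z => G z j m) y + partialD j (fun z => G z i m) y
        - partialD m (fun z => G z i j) y) := by
  set T : Fin n → ℝ := fun l => partialD i (fun z => G z j l) y + partialD j (fun z => G z i l) y
        - partialD l (fun z => G z i j) y with hT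
  have h : (G y).mulVec ((G y)⁻¹.mulVec T) = T := by
    rw [Matrix.mulVec_mulVec, Matrix.mul_nonsing_inv _ (hG.isUnit_det hy), Matrix.one_mulVec]
  have h' := congrFun h m
  simp only [Matrix.mulVec, dotProduct] at h'
  change _ = 1 / 2 * T m
  rw [← h', Finset.mul_sum]
  refine Finset.sum_congr rfl fun k _ => ?_
  simp only [christoffel]
  ring

/-- The derivative of the inverse matrix. -/
theorem partialD_inv (hy : y ∈ U) (j : Fin n) :
    (Matrix.of fun a b => partialD j (fun z => (G z)⁻¹ a b) y) =
      -((G y)⁻¹ * (Matrix.of fun a b => partialD j (fun z => G z a b) y) * (G y)⁻¹) := by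
  set A := Matrix.of fun a b => partialD j (fun z => G z a b) y with hA
  set B := Matrix.of fun a b => partialD j (fun z => (G z)⁻¹ a b) y with hB
  -- Differentiate `G G⁻¹ = 1`, which is known only on `U`, hence near `y`.
  have h : A * (G y)⁻¹ + G y * B = 0 := by
    ext a b
    have h1 : partialD j (fun z => ∑ c, G z a c * (G z)⁻¹ c b) y = 0 := by
      have : (fun z => ∑ c, G z a c * (G z)⁻¹ c b) =ᶠ[nhds y]
          fun _ => (1 : Matrix (Fin n) (Fin n) ℝ) a b := by
        filter_upwards [hG.eventually_mem hy] with z hz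
        rw [← Matrix.mul_apply, Matrix.mul_nonsing_inv _ (hG.isUnit_det hz)]
      rw [partialD_congr j this]
      simp [partialD]
    have hd1 := fun a b => (hG.contDiffAt y hy a b).differentiableAt (by simp)
    have hd2 := fun a b => (hG.contDiffAt_inv hy a b).differentiableAt (by simp)
    rw [partialD_sum j fun c _ => (hd1 a c).fun_mul (hd2 c b)] at h1
    simp only [fun c => partialD_mul j (hd1 a c) (hd2 c b), Finset.sum_add_distrib] at h1
    simpa [Matrix.mul_apply, hA, hB] using h1
  have h2 : (G y)⁻¹ * (A * (G y)⁻¹ + G y * B) = 0 := by rw [h, Matrix.mul_zero]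
  rw [Matrix.mul_add, ← Matrix.mul_assoc, ← Matrix.mul_assoc,
    Matrix.nonsing_inv_mul _ (hG.isUnit_det hy), Matrix.one_mul] at h2
  exact eq_neg_of_add_eq_zero_right h2

theorem inv_symm (hy : y ∈ U) (i j : Fin n) : (G y)⁻¹ i j = (G y)⁻¹ j i := by
  simpa using ((hG.posDef y hy).inv.1.apply i j).symm

/-- The contracted Christoffel symbols. -/
theorem sum_christoffel (hy : y ∈ U) (k : Fin n) :
    ∑ i, christoffel G i i k y =
      (1 / 2) * ∑ i, ∑ l, (G y)⁻¹ i l * partialD k (fun z => G z i l) y := by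
  simp only [christoffel, ← Finset.mul_sum]
  congr 1
  have h : ∑ i, ∑ l, (G y)⁻¹ i l * partialD i (fun z => G z k l) y =
      ∑ i, ∑ l, (G y)⁻¹ i l * partialD l (fun z => G z i k) y := by
    rw [Finset.sum_comm]
    refine Finset.sum_congr rfl fun i _ => Finset.sum_congr rfl fun l _ => ?_
    rw [hG.inv_symm hy l i, hG.partialD_symm hy l k i]
  simp only [mul_sub, mul_add, Finset.sum_sub_distrib, Finset.sum_add_distrib, h]
  ring

/-- The contracted symbol `Γ^i_{ik}` is `∂_k log √(det G)`, so its derivative is a Hessian. The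
logarithm is avoided by differentiating `½ tr(G⁻¹ ∂_k G)`: the result `½ (tr(G⁻¹ ∂_j∂_k G) - tr(G⁻¹
∂_jG G⁻¹ ∂_kG))` is symmetric because partial derivatives commute and the trace is cyclic. -/
theorem partialD_sum_christoffel_symm (hy : y ∈ U) (j k : Fin n) :
    partialD j (fun z => ∑ i, christoffel G i i k z) y =
      partialD k (fun z => ∑ i, christoffel G i i j z) y := by
  have hd := fun k i l =>
    (contDiffAt_partialD k (hG.contDiffAt y hy i l)).differentiableAt (by simp)
  have hd2 := fun a b => (hG.contDiffAt_inv hy a b).differentiableAt (by simp)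
  set A := fun j => Matrix.of fun a b => partialD j (fun z => G z a b) y with hA
  have hAs : ∀ j, (A j).transpose = A j := fun j => by
    ext a b
    exact hG.partialD_symm hy j b a
  have key (j k : Fin n) : partialD j (fun z => ∑ i, christoffel G i i k z) y =
      (1 / 2) * (∑ i, ∑ l, (G y)⁻¹ i l * partialD j (partialD k (fun z => G z i l)) y
        - (((G y)⁻¹ * A j) * ((G y)⁻¹ * A k)).trace) := by
    have h0 : (fun z => ∑ i, christoffel G i i k z) =ᶠ[nhds y] fun z =>
        (1 / 2) * ∑ i, ∑ l, (G z)⁻¹ i l * partialD k (fun z => G z i l) z := by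
      filter_upwards [hG.eventually_mem hy] with z hz using hG.sum_christoffel hz k
    rw [partialD_congr j h0, partialD_mul j (differentiableAt_const _)
      (DifferentiableAt.fun_sum fun i _ => DifferentiableAt.fun_sum fun l _ =>
        (hd2 i l).fun_mul (hd k i l)),
      partialD_sum j fun i _ => DifferentiableAt.fun_sum fun l _ => (hd2 i l).fun_mul (hd k i l)]
    simp only [fun i => partialD_sum (s := Finset.univ) (y := y) j
      fun l _ => (hd2 i l).fun_mul (hd k i l), fun i l => partialD_mul j (hd2 i l) (hd k i l)]
    have h1 : ∑ i, ∑ l, partialD j (fun z => (G z)⁻¹ i l) y * partialD k (fun z => G z i l) y =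
        - (((G y)⁻¹ * A j) * ((G y)⁻¹ * A k)).trace := by
      have e := hG.partialD_inv hy j
      have : ∑ i, ∑ l, partialD j (fun z => (G z)⁻¹ i l) y * partialD k (fun z => G z i l) y =
        ((Matrix.of fun a b => partialD j (fun z => (G z)⁻¹ a b) y) * (A k).transpose).trace := by
        simp [Matrix.trace, Matrix.mul_apply, hA]
      rw [this, e, hAs, Matrix.neg_mul, Matrix.trace_neg, Matrix.mul_assoc ((G y)⁻¹ * _)]
    have h2 : partialD j (fun _ : Model n => (1 / 2 : ℝ)) y = 0 := by simp [partialD]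
    simp only [Finset.sum_add_distrib]
    rw [h1, h2]
    ring
  rw [key, key, Matrix.trace_mul_comm]
  simp only [fun i l => partialD_comm j k (hG.contDiffAt y hy i l)]

/-- The only term that does not inherit symmetry from `Γ^k_{ij} = Γ^k_{ji}` is `∂_j Γ^i_{ik}`, which
`partialD_sum_christoffel_symm` handles. -/
theorem ricci_symm (hy : y ∈ U) (j k : Fin n) : ricci G j k y = ricci G k j y := by
  have hd := fun k i j => (hG.contDiffAt_christoffel hy k i j).differentiableAt (by simp)
  have hs (k : Fin n) (i j : Fin n) (l : Fin n) : partialD l (christoffel G k i j) y =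
      partialD l (christoffel G k j i) y :=
    partialD_congr l (by
      filter_upwards [hG.eventually_mem hy] with z hz using hG.christoffel_symm hz k i j)
  have key (j k : Fin n) : ricci G j k y = ∑ i, partialD i (christoffel G i j k) y
      - partialD j (fun z => ∑ i, christoffel G i i k z) y
      + (∑ i, ∑ p, christoffel G i i p y * christoffel G p j k y
        - ∑ i, ∑ p, christoffel G i j p y * christoffel G p i k y) := by
    rw [partialD_sum j fun i _ => hd i i k]
    simp only [ricci, curvature, Finset.sum_add_distrib, Finset.sum_sub_distrib]
  rw [key, key, hG.partialD_sum_christoffel_symm hy j k]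
  have h : ∑ i, ∑ p, christoffel G i j p y * christoffel G p i k y =
      ∑ i, ∑ p, christoffel G i k p y * christoffel G p i j y := by
    rw [Finset.sum_comm]
    refine Finset.sum_congr rfl fun i _ => Finset.sum_congr rfl fun p _ => ?_
    rw [hG.christoffel_symm hy p j i, hG.christoffel_symm hy i p k]
    ring
  rw [h]
  simp only [fun i => hs i j k i, fun p => hG.christoffel_symm hy p j k]

end IsMetricOn

end LocalMetric

/-! ### Connections and curvature under a change of coordinates. -/

section Transformation

variable {E : Type*} [NormedAddCommGroup E] [NormedSpace ℝ E]

/-- The curvature `R(X, Y) Z` of the connection `∂ + Γ`. -/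
def curv (Γ : E → E →L[ℝ] E →L[ℝ] E) (y X Y Z : E) : E :=
  fderiv ℝ Γ y X Y Z - fderiv ℝ Γ y Y X Z + Γ y X (Γ y Y Z) - Γ y Y (Γ y X Z)

theorem fderiv_apply_apply {F : Type*} [NormedAddCommGroup F] [NormedSpace ℝ F]
    {B : E → E →L[ℝ] E →L[ℝ] F} {y : E} (hB : DifferentiableAt ℝ B y) (X Y Z : E) :
    fderiv ℝ (fun z => B z Y Z) y X = fderiv ℝ B y X Y Z := by
  rw [fderiv_clm_apply (hB.clm_apply (by fun_prop)) (by fun_prop),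
    fderiv_clm_apply hB (by fun_prop)]
  simp

theorem fderiv_comp_apply {F : Type*} [NormedAddCommGroup F] [NormedSpace ℝ F]
    {B : E → F} {φ : E → E} {y : E} (hB : DifferentiableAt ℝ B (φ y))
    (hφ : DifferentiableAt ℝ φ y) (X : E) :
    fderiv ℝ (fun z => B (φ z)) y X = fderiv ℝ B (φ y) (fderiv ℝ φ y X) := by
  change fderiv ℝ (B ∘ φ) y X = _
  rw [fderiv_comp y hB hφ]
  rfl

theorem contDiffAt_sum_smul_const {F ι : Type*} [NormedAddCommGroup F] [NormedSpace ℝ F]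
    {s : Finset ι} {f : ι → E → ℝ} {v : ι → F} {y : E} (hf : ∀ i ∈ s, ContDiffAt ℝ ∞ (f i) y) :
    ContDiffAt ℝ ∞ (fun z => ∑ i ∈ s, f i z • v i) y :=
  ContDiffAt.sum fun i hi => (hf i hi).smul contDiffAt_const

variable {g h : E → E →L[ℝ] E →L[ℝ] ℝ} {Γ Δ : E → E →L[ℝ] E →L[ℝ] E} {φ : E → E} {y : E}

set_option synthInstance.maxHeartbeats 200000 in
/-- The transformation law of the Christoffel symbols. -/
theorem koszul_transform (hdG : DifferentiableAt ℝ g y) (hdH : DifferentiableAt ℝ h (φ y))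
    (hG : ∀ X Y Z, 2 * g y (Γ y X Y) Z = fderiv ℝ g y X Y Z + fderiv ℝ g y Y X Z
      - fderiv ℝ g y Z X Y)
    (hH : ∀ X Y Z, 2 * h (φ y) (Δ (φ y) X Y) Z = fderiv ℝ h (φ y) X Y Z
      + fderiv ℝ h (φ y) Y X Z - fderiv ℝ h (φ y) Z X Y)
    (hHs : ∀ X Y, h (φ y) X Y = h (φ y) Y X) (hHp : ∀ X, X ≠ 0 → 0 < h (φ y) X X)
    (hφ : ContDiffAt ℝ ∞ φ y)
    (hform : ∀ᶠ z in nhds y, ∀ X Y,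
      g z X Y = h (φ z) (fderiv ℝ φ z X) (fderiv ℝ φ z Y))
    (hsurj : Function.Surjective (fderiv ℝ φ y)) (X Y : E) :
    fderiv ℝ φ y (Γ y X Y) =
      Δ (φ y) (fderiv ℝ φ y X) (fderiv ℝ φ y Y) + fderiv ℝ (fderiv ℝ φ) y X Y := by
  have hdφ : DifferentiableAt ℝ φ y := hφ.differentiableAt (by simp)
  have hd2φ : DifferentiableAt ℝ (fderiv ℝ φ) y :=
    (hφ.fderiv_right (m := ∞) (by simp)).differentiableAt (by simp)
  have hsym : ∀ X Y, fderiv ℝ (fderiv ℝ φ) y X Y = fderiv ℝ (fderiv ℝ φ) y Y X :=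
    (hφ.isSymmSndFDerivAt (by simpa using WithTop.coe_le_coe.2 (le_top : (2 : ℕ∞) ≤ ⊤))).eq
  have hdc : DifferentiableAt ℝ (fun z => h (φ z)) y :=
    DifferentiableAt.comp (g := h) y hdH hdφ
  -- The derivative of `g = φ^* h` in the direction `X`.
  have D (X Y Z : E) : fderiv ℝ g y X Y Z =
      fderiv ℝ h (φ y) (fderiv ℝ φ y X) (fderiv ℝ φ y Y) (fderiv ℝ φ y Z)
      + h (φ y) (fderiv ℝ (fderiv ℝ φ) y X Y) (fderiv ℝ φ y Z)
      + h (φ y) (fderiv ℝ φ y Y) (fderiv ℝ (fderiv ℝ φ) y X Z) := by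
    have h1 : fderiv ℝ g y X Y Z = fderiv ℝ (fun z => g z Y Z) y X := by
      rw [fderiv_clm_apply (hdG.clm_apply (by fun_prop)) (by fun_prop),
        fderiv_clm_apply hdG (by fun_prop)]
      simp
    have h2 : (fun z => g z Y Z) =ᶠ[nhds y]
        fun z => h (φ z) (fderiv ℝ φ z Y) (fderiv ℝ φ z Z) := by
      filter_upwards [hform] with z hz using hz Y Z
    have h3 (Y : E) : DifferentiableAt ℝ (fun z => fderiv ℝ φ z Y) y :=
      hd2φ.clm_apply (by fun_prop)
    have h4 (Y : E) : fderiv ℝ (fun z => fderiv ℝ φ z Y) y X =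
        fderiv ℝ (fderiv ℝ φ) y X Y := by
      rw [fderiv_clm_apply hd2φ (by fun_prop)]
      simp
    have h5 : fderiv ℝ (fun z => h (φ z)) y X =
        fderiv ℝ h (φ y) (fderiv ℝ φ y X) :=
      fderiv_comp_apply (B := h) hdH hdφ X
    rw [h1, h2.fderiv_eq, fderiv_clm_apply (hdc.clm_apply (h3 Y)) (h3 Z),
      fderiv_clm_apply hdc (h3 Y)]
    simp only [add_apply, ContinuousLinearMap.comp_apply,
      ContinuousLinearMap.flip_apply, h4, h5]
    ring
  -- In the Koszul combination of the three instances of `D`, all second derivatives of `φ` cancel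
  -- except those along `(X, Y)`. Surjectivity of `Dφ` lets `W` be arbitrary, in particular the
  -- difference itself.
  have key : ∀ W, h (φ y) (fderiv ℝ φ y (Γ y X Y) -
      (Δ (φ y) (fderiv ℝ φ y X) (fderiv ℝ φ y Y) + fderiv ℝ (fderiv ℝ φ) y X Y)) W = 0 := by
    intro W
    obtain ⟨Z, rfl⟩ := hsurj W
    have e1 := hG X Y Z
    have e2 := hH (fderiv ℝ φ y X) (fderiv ℝ φ y Y) (fderiv ℝ φ y Z)
    rw [D, D, D, hform.self_of_nhds] at e1
    rw [hsym Z X, hsym Z Y, hsym Y X] at e1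
    have e3 := hHs (fderiv ℝ φ y X) (fderiv ℝ (fderiv ℝ φ) y Y Z)
    have e4 := hHs (fderiv ℝ φ y Y) (fderiv ℝ (fderiv ℝ φ) y X Z)
    simp only [map_sub, map_add, sub_apply, add_apply]
    linarith
  by_contra hne
  exact (hHp _ (sub_ne_zero.2 hne)).ne' (key _)

set_option synthInstance.maxHeartbeats 200000 in
/-- The transformation law of the curvature. -/
theorem curv_transform (hdG : DifferentiableAt ℝ Γ y) (hdH : DifferentiableAt ℝ Δ (φ y))
    (hφ : ContDiffAt ℝ ∞ φ y)
    (hconn : ∀ᶠ z in nhds y, ∀ X Y, fderiv ℝ φ z (Γ z X Y) =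
      Δ (φ z) (fderiv ℝ φ z X) (fderiv ℝ φ z Y) + fderiv ℝ (fderiv ℝ φ) z X Y)
    (X Y Z : E) :
    fderiv ℝ φ y (curv Γ y X Y Z) =
      curv Δ (φ y) (fderiv ℝ φ y X) (fderiv ℝ φ y Y) (fderiv ℝ φ y Z) := by
  have hdφ : DifferentiableAt ℝ φ y := hφ.differentiableAt (by simp)
  have hφ1 : ContDiffAt ℝ ∞ (fderiv ℝ φ) y := hφ.fderiv_right (m := ∞) (by simp)
  have hφ2 : ContDiffAt ℝ ∞ (fderiv ℝ (fderiv ℝ φ)) y := hφ1.fderiv_right (m := ∞) (by simp)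
  have hd1 : DifferentiableAt ℝ (fderiv ℝ φ) y := hφ1.differentiableAt (by simp)
  have hd2 : DifferentiableAt ℝ (fderiv ℝ (fderiv ℝ φ)) y := hφ2.differentiableAt (by simp)
  have h2 : (2 : WithTop ℕ∞) ≤ ∞ := WithTop.coe_le_coe.2 (le_top : (2 : ℕ∞) ≤ ⊤)
  have hsym : ∀ X Y, fderiv ℝ (fderiv ℝ φ) y X Y = fderiv ℝ (fderiv ℝ φ) y Y X :=
    (hφ.isSymmSndFDerivAt (by simpa using h2)).eq
  have hsym2 : ∀ X Y, fderiv ℝ (fderiv ℝ (fderiv ℝ φ)) y X Y =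
      fderiv ℝ (fderiv ℝ (fderiv ℝ φ)) y Y X :=
    (hφ1.isSymmSndFDerivAt (by simpa using h2)).eq
  have hdc : DifferentiableAt ℝ (fun z => Δ (φ z)) y :=
    DifferentiableAt.comp (g := Δ) y hdH hdφ
  -- The derivative of `hconn` in the direction `X`. Antisymmetrising in `X, Y` removes the third
  -- derivatives of `φ`.
  have D (X Y Z : E) : fderiv ℝ (fderiv ℝ φ) y X (Γ y Y Z)
      + fderiv ℝ φ y (fderiv ℝ Γ y X Y Z) =
      fderiv ℝ Δ (φ y) (fderiv ℝ φ y X) (fderiv ℝ φ y Y) (fderiv ℝ φ y Z)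
      + Δ (φ y) (fderiv ℝ (fderiv ℝ φ) y X Y) (fderiv ℝ φ y Z)
      + Δ (φ y) (fderiv ℝ φ y Y) (fderiv ℝ (fderiv ℝ φ) y X Z)
      + fderiv ℝ (fderiv ℝ (fderiv ℝ φ)) y X Y Z := by
    have hc : DifferentiableAt ℝ (fun z => Γ z Y Z) y :=
      (hdG.clm_apply (by fun_prop)).clm_apply (by fun_prop)
    have h1 : fderiv ℝ (fun z => Γ z Y Z) y X = fderiv ℝ Γ y X Y Z :=
      fderiv_apply_apply hdG X Y Z
    have hL : fderiv ℝ (fun z => fderiv ℝ φ z (Γ z Y Z)) y X =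
        fderiv ℝ (fderiv ℝ φ) y X (Γ y Y Z) + fderiv ℝ φ y (fderiv ℝ Γ y X Y Z) := by
      rw [fderiv_clm_apply hd1 hc]
      simp only [add_apply, ContinuousLinearMap.comp_apply,
        ContinuousLinearMap.flip_apply, h1]
      rw [add_comm]
    have h3 (Y : E) : DifferentiableAt ℝ (fun z => fderiv ℝ φ z Y) y :=
      hd1.clm_apply (by fun_prop)
    have h4 (Y : E) : fderiv ℝ (fun z => fderiv ℝ φ z Y) y X =
        fderiv ℝ (fderiv ℝ φ) y X Y := by
      rw [fderiv_clm_apply hd1 (by fun_prop)]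
      simp
    have h5 : fderiv ℝ (fun z => Δ (φ z)) y X =
        fderiv ℝ Δ (φ y) (fderiv ℝ φ y X) :=
      fderiv_comp_apply (B := Δ) hdH hdφ X
    have h6 : DifferentiableAt ℝ (fun z => fderiv ℝ (fderiv ℝ φ) z Y Z) y :=
      (hd2.clm_apply (by fun_prop)).clm_apply (by fun_prop)
    have h7 : fderiv ℝ (fun z => fderiv ℝ (fderiv ℝ φ) z Y Z) y X =
        fderiv ℝ (fderiv ℝ (fderiv ℝ φ)) y X Y Z := by
      rw [fderiv_clm_apply (hd2.clm_apply (by fun_prop)) (by fun_prop),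
        fderiv_clm_apply hd2 (by fun_prop)]
      simp
    have he : (fun z => fderiv ℝ φ z (Γ z Y Z)) =ᶠ[nhds y] fun z =>
        Δ (φ z) (fderiv ℝ φ z Y) (fderiv ℝ φ z Z) + fderiv ℝ (fderiv ℝ φ) z Y Z := by
      filter_upwards [hconn] with z hz using hz Y Z
    rw [← hL, he.fderiv_eq, fderiv_fun_add ((hdc.clm_apply (h3 Y)).clm_apply (h3 Z)) h6,
      fderiv_clm_apply (hdc.clm_apply (h3 Y)) (h3 Z), fderiv_clm_apply hdc (h3 Y)]
    simp only [add_apply, ContinuousLinearMap.comp_apply,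
      ContinuousLinearMap.flip_apply, h4, h5, h7]
    abel
  have C := hconn.self_of_nhds
  have e1 := D X Y Z
  have e2 := D Y X Z
  rw [← eq_sub_iff_add_eq'] at e1 e2
  simp only [curv, map_sub, map_add, e1, e2, C]
  rw [hsym Y X, hsym2 Y X]
  abel

end Transformation

/-! ### The metric, the connection and the curvature as multilinear maps. -/

section Tensors

variable {n : ℕ}

/-- The bilinear form on `ℝⁿ` with matrix `G y`. -/
def form (G : Model n → Matrix (Fin n) (Fin n) ℝ) (y : Model n) : Model n →L[ℝ] Model n →L[ℝ] ℝ :=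
  ∑ i, ∑ j, G y i j • (EuclideanSpace.proj i : Model n →L[ℝ] ℝ).smulRight
    (EuclideanSpace.proj j : Model n →L[ℝ] ℝ)

/-- The Christoffel symbols as a bilinear map. -/
def conn (G : Model n → Matrix (Fin n) (Fin n) ℝ) (y : Model n) :
    Model n →L[ℝ] Model n →L[ℝ] Model n :=
  ∑ i, ∑ j, ∑ k, christoffel G k i j y • (EuclideanSpace.proj i : Model n →L[ℝ] ℝ).smulRight
    ((EuclideanSpace.proj j : Model n →L[ℝ] ℝ).smulRight (basisVec k))

/-- The curvature `R(X, Y) Z`. -/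
abbrev riem (G : Model n → Matrix (Fin n) (Fin n) ℝ) (y X Y Z : Model n) : Model n :=
  curv (conn G) y X Y Z

variable {G : Model n → Matrix (Fin n) (Fin n) ℝ} {y : Model n}

theorem form_apply (X Y : Model n) : form G y X Y = ∑ i, ∑ j, G y i j * (X i * Y j) := by
  simp [form]

theorem form_self_apply (X : Model n) :
    form G y X X = star (X : Fin n → ℝ) ⬝ᵥ (G y).mulVec (X : Fin n → ℝ) := by
  rw [form_apply]
  simp only [dotProduct, Matrix.mulVec, Finset.mul_sum]
  refine Finset.sum_congr rfl fun i _ => Finset.sum_congr rfl fun j _ => ?_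
  rw [Pi.star_apply, star_trivial]
  ring

theorem form_basisVec (i j : Fin n) : form G y (basisVec i) (basisVec j) = G y i j := by
  simp [form_apply]

theorem form_basisVec_right (X : Model n) (j : Fin n) :
    form G y X (basisVec j) = ∑ i, G y i j * X i := by
  simp [form_apply]

theorem conn_apply (X Y : Model n) (k : Fin n) :
    conn G y X Y k = ∑ i, ∑ j, christoffel G k i j y * (X i * Y j) := by
  simp [conn, Pi.single_apply]

theorem conn_basisVec (i j k : Fin n) :
    conn G y (basisVec i) (basisVec j) k = christoffel G k i j y := by
  simp [conn_apply]

theorem conn_basisVec_left (i k : Fin n) (Y : Model n) :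
    conn G y (basisVec i) Y k = ∑ j, christoffel G k i j y * Y j := by
  simp [conn_apply]

namespace IsMetricOn

variable {U : Set (Model n)} (hG : IsMetricOn G U)
include hG

theorem contDiffAt_form (hy : y ∈ U) : ContDiffAt ℝ ∞ (form G) y := by
  unfold form
  exact ContDiffAt.sum fun i _ => contDiffAt_sum_smul_const fun j _ => hG.contDiffAt y hy i j

theorem contDiffAt_conn (hy : y ∈ U) : ContDiffAt ℝ ∞ (conn G) y := by
  unfold conn
  exact ContDiffAt.sum fun i _ => ContDiffAt.sum fun j _ =>
    contDiffAt_sum_smul_const fun k _ => hG.contDiffAt_christoffel hy k i j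

theorem form_symm (hy : y ∈ U) (X Y : Model n) : form G y X Y = form G y Y X := by
  rw [form_apply, form_apply, Finset.sum_comm]
  refine Finset.sum_congr rfl fun i _ => Finset.sum_congr rfl fun j _ => ?_
  rw [hG.symm hy j i]
  ring

theorem form_pos (hy : y ∈ U) {X : Model n} (hX : X ≠ 0) : 0 < form G y X X := by
  have h0 : (X : Fin n → ℝ) ≠ 0 := fun h => hX (by ext i; exact congrFun h i)
  have h := (hG.posDef y hy).dotProduct_mulVec_pos h0
  rw [form_self_apply]
  exact h

theorem conn_symm (hy : y ∈ U) (X Y : Model n) : conn G y X Y = conn G y Y X := by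
  ext k
  rw [conn_apply, conn_apply, Finset.sum_comm]
  refine Finset.sum_congr rfl fun i _ => Finset.sum_congr rfl fun j _ => ?_
  rw [hG.christoffel_symm hy k j i]
  ring

theorem fderiv_form (hy : y ∈ U) (i j l : Fin n) :
    fderiv ℝ (form G) y (basisVec l) (basisVec i) (basisVec j) =
      partialD l (fun z => G z i j) y := by
  have h := (hG.contDiffAt_form hy).differentiableAt (by simp)
  have e : (fun z => G z i j) = fun z => form G z (basisVec i) (basisVec j) := by
    ext z; rw [form_basisVec]
  rw [e, partialD, fderiv_apply_apply h]

theorem fderiv_conn (hy : y ∈ U) (i j k l : Fin n) :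
    fderiv ℝ (conn G) y (basisVec l) (basisVec i) (basisVec j) k =
      partialD l (christoffel G k i j) y := by
  have h := (hG.contDiffAt_conn hy).differentiableAt (by simp)
  have e : christoffel G k i j = fun z =>
      (EuclideanSpace.proj k : Model n →L[ℝ] ℝ) (conn G z (basisVec i) (basisVec j)) := by
    ext z; simp [← conn_basisVec]
  have h2 : DifferentiableAt ℝ (fun z => conn G z (basisVec i) (basisVec j)) y :=
    (h.clm_apply (by fun_prop)).clm_apply (by fun_prop)
  rw [e, partialD, fderiv_clm_apply (by fun_prop) h2]
  simp [fderiv_apply_apply h]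

theorem riem_basisVec (hy : y ∈ U) (i j k l : Fin n) :
    riem G y (basisVec i) (basisVec j) (basisVec k) l = curvature G l i j k y := by
  simp only [riem, curv, PiLp.add_apply, PiLp.sub_apply, hG.fderiv_conn hy, conn_basisVec_left,
    curvature, Finset.sum_sub_distrib]
  simp
  ring

set_option synthInstance.maxHeartbeats 200000 in
-- The Koszul formula for constant vector fields, in the form `koszul_transform` needs. Both sides
-- are trilinear, so it reduces to `sum_mul_christoffel` on basis vectors.
theorem form_conn (hy : y ∈ U) (X Y Z : Model n) :
    2 * form G y (conn G y X Y) Z = fderiv ℝ (form G) y X Y Z + fderiv ℝ (form G) y Y X Z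
      - fderiv ℝ (form G) y Z X Y := by
  revert X Y Z
  have h0 (i j l : Fin n) : 2 * form G y (conn G y (basisVec i) (basisVec j)) (basisVec l) =
      fderiv ℝ (form G) y (basisVec i) (basisVec j) (basisVec l)
      + fderiv ℝ (form G) y (basisVec j) (basisVec i) (basisVec l)
      - fderiv ℝ (form G) y (basisVec l) (basisVec i) (basisVec j) := by
    simp only [hG.fderiv_form hy, form_basisVec_right, conn_basisVec]
    have := hG.sum_mul_christoffel hy l i j
    simp only [fun k => hG.symm hy l k] at this
    rw [this]
    ring
  intro X Y Z
  refine IsLinearMap.eq_of_basisVec (f := fun Z => 2 * form G y (conn G y X Y) Z)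
    (g := fun Z => fderiv ℝ (form G) y X Y Z + fderiv ℝ (form G) y Y X Z
      - fderiv ℝ (form G) y Z X Y) ?_ ?_ (fun l => ?_) Z
  · constructor <;> intros <;> simp <;> ring
  · constructor <;> intros <;> simp <;> ring
  refine IsLinearMap.eq_of_basisVec (f := fun Y => 2 * form G y (conn G y X Y) (basisVec l))
    (g := fun Y => fderiv ℝ (form G) y X Y (basisVec l) + fderiv ℝ (form G) y Y X (basisVec l)
      - fderiv ℝ (form G) y (basisVec l) X Y) ?_ ?_ (fun j => ?_) Y
  · constructor <;> intros <;> simp <;> ring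
  · constructor <;> intros <;> simp <;> ring
  refine IsLinearMap.eq_of_basisVec
    (f := fun X => 2 * form G y (conn G y X (basisVec j)) (basisVec l))
    (g := fun X => fderiv ℝ (form G) y X (basisVec j) (basisVec l)
      + fderiv ℝ (form G) y (basisVec j) X (basisVec l)
      - fderiv ℝ (form G) y (basisVec l) X (basisVec j)) ?_ ?_ (fun i => ?_) X
  · constructor <;> intros <;> simp <;> ring
  · constructor <;> intros <;> simp <;> ring
  exact h0 i j l

theorem fderiv_form_symm (hy : y ∈ U) (X Y Z : Model n) :
    fderiv ℝ (form G) y X Y Z = fderiv ℝ (form G) y X Z Y := by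
  have h := (hG.contDiffAt_form hy).differentiableAt (by simp)
  have key (Y Z : Model n) : fderiv ℝ (form G) y X Y Z =
      fderiv ℝ (fun z => form G z Y Z) y X := (fderiv_apply_apply h X Y Z).symm
  rw [key, key, Filter.EventuallyEq.fderiv_eq]
  filter_upwards [hG.eventually_mem hy] with z hz using hG.form_symm hz Y Z

/-- The metric is parallel. -/
theorem fderiv_form_eq (hy : y ∈ U) (X Y Z : Model n) :
    fderiv ℝ (form G) y X Y Z = form G y (conn G y X Y) Z + form G y Y (conn G y X Z) := by
  have h1 := hG.form_conn hy X Y Z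
  have h2 := hG.form_conn hy X Z Y
  rw [hG.form_symm hy] at h2
  have h3 := hG.fderiv_form_symm hy X Y Z
  have h4 := hG.fderiv_form_symm hy Y X Z
  have h5 := hG.fderiv_form_symm hy Z X Y
  linarith

end IsMetricOn

end Tensors

/-! ### Multilinearity of the curvature, and recurrent vector fields. -/

section Recurrent

variable {E : Type*} [NormedAddCommGroup E] [NormedSpace ℝ E]
  {Γ : E → E →L[ℝ] E →L[ℝ] E} {y : E}

set_option synthInstance.maxHeartbeats 200000 in
theorem isLinearMap_curv_left (Y Z : E) : IsLinearMap ℝ (fun X => curv Γ y X Y Z) := by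
  constructor
  · intro a b
    simp only [curv, map_add, add_apply]
    abel
  · intro c a
    simp only [curv, ContinuousLinearMap.map_smul, smul_apply]
    module

set_option synthInstance.maxHeartbeats 200000 in
theorem isLinearMap_curv_middle (X Z : E) : IsLinearMap ℝ (fun Y => curv Γ y X Y Z) := by
  constructor
  · intro a b
    simp only [curv, map_add, add_apply]
    abel
  · intro c a
    simp only [curv, ContinuousLinearMap.map_smul, smul_apply]
    module

set_option synthInstance.maxHeartbeats 200000 in
theorem isLinearMap_curv_right (X Y : E) : IsLinearMap ℝ (fun Z => curv Γ y X Y Z) := by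
  constructor
  · intro a b
    simp only [curv, map_add]
    abel
  · intro c a
    simp only [curv, map_smul]
    module

set_option synthInstance.maxHeartbeats 200000 in
/-- The Ricci identity for a vector field `v` with `∇v = θ ⊗ v`. -/
theorem curv_of_recurrent {v : E → E} {θ : E → E →L[ℝ] ℝ}
    (hΓ : DifferentiableAt ℝ Γ y) (hv : ContDiffAt ℝ ∞ v y) (hθ : DifferentiableAt ℝ θ y)
    (h : ∀ᶠ z in nhds y, ∀ X, fderiv ℝ v z X = θ z X • v z - Γ z X (v z)) (X Y : E) :
    curv Γ y X Y (v y) = (fderiv ℝ θ y X Y - fderiv ℝ θ y Y X) • v y := by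
  have hdv : DifferentiableAt ℝ v y := hv.differentiableAt (by simp)
  have hd1 : DifferentiableAt ℝ (fderiv ℝ v) y :=
    (hv.fderiv_right (m := ∞) (by simp)).differentiableAt (by simp)
  have hsym : ∀ X Y, fderiv ℝ (fderiv ℝ v) y X Y = fderiv ℝ (fderiv ℝ v) y Y X :=
    (hv.isSymmSndFDerivAt (by simpa using WithTop.coe_le_coe.2 (le_top : (2 : ℕ∞) ≤ ⊤))).eq
  have C := h.self_of_nhds
  -- Differentiate the equation for `Dv` and substitute it back. The symmetry of `D²v` is then the
  -- integrability condition sought.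
  have D (X Y : E) : fderiv ℝ (fderiv ℝ v) y X Y =
      θ y Y • (θ y X • v y - Γ y X (v y)) + fderiv ℝ θ y X Y • v y
        - (Γ y Y (θ y X • v y - Γ y X (v y)) + fderiv ℝ Γ y X Y (v y)) := by
    have h1 : fderiv ℝ (fun z => fderiv ℝ v z Y) y X = fderiv ℝ (fderiv ℝ v) y X Y := by
      rw [fderiv_clm_apply hd1 (by fun_prop)]
      simp
    have he : (fun z => fderiv ℝ v z Y) =ᶠ[nhds y] fun z => θ z Y • v z - Γ z Y (v z) := by
      filter_upwards [h] with z hz using hz Y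
    have hθY : DifferentiableAt ℝ (fun z => θ z Y) y := hθ.clm_apply (by fun_prop)
    have hΓY : DifferentiableAt ℝ (fun z => Γ z Y) y := hΓ.clm_apply (by fun_prop)
    have h2 : fderiv ℝ (fun z => θ z Y) y X = fderiv ℝ θ y X Y := by
      rw [fderiv_clm_apply hθ (by fun_prop)]
      simp
    have h3 : fderiv ℝ (fun z => Γ z Y) y X = fderiv ℝ Γ y X Y := by
      rw [fderiv_clm_apply hΓ (by fun_prop)]
      simp
    rw [← h1, he.fderiv_eq, fderiv_fun_sub (hθY.fun_smul hdv) (hΓY.clm_apply hdv),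
      fderiv_fun_smul hθY hdv, fderiv_clm_apply hΓY hdv]
    simp only [add_apply, sub_apply, smul_apply, ContinuousLinearMap.smulRight_apply,
      ContinuousLinearMap.comp_apply, ContinuousLinearMap.flip_apply, h2, h3, C]
  have e := hsym X Y
  rw [D, D] at e
  simp only [map_sub, map_smul] at e
  rw [← sub_eq_zero] at e ⊢
  rw [← neg_eq_zero, ← e]
  simp only [curv]
  module

end Recurrent

/-! ### The Ricci tensor as a trace: the rank one contradiction and chart independence. -/

section RicciForm

theorem map_eq_sum_basisVec {n : ℕ} {F : Type*} [AddCommGroup F] [Module ℝ F]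
    [TopologicalSpace F] (f : Model n →L[ℝ] F) (X : Model n) : f X = ∑ i, X i • f (basisVec i) := by
  conv_lhs => rw [← sum_smul_basisVec X]
  simp only [map_sum, map_smul]

variable {n : ℕ} {G : Model n → Matrix (Fin n) (Fin n) ℝ} {U : Set (Model n)} {y : Model n}

/-- The left side is the trace of `X ↦ R(X, Y)Z`. This serves both to contract the Ricci identity
and to compare charts. -/
theorem IsMetricOn.sum_riem (hG : IsMetricOn G U) (hy : y ∈ U) (Y Z : Model n) :
    ∑ i, riem G y (basisVec i) Y Z i = ∑ j, ∑ k, ricci G j k y * (Y j * Z k) := by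
  refine IsLinearMap.eq_of_basisVec (f := fun Y => ∑ i, riem G y (basisVec i) Y Z i)
    (g := fun Y => ∑ j, ∑ k, ricci G j k y * (Y j * Z k)) ?_ ?_ (fun j => ?_) Y
  · constructor
    · intro a b
      simp [(isLinearMap_curv_middle _ _).map_add, Finset.sum_add_distrib]
    · intro c a
      simp [(isLinearMap_curv_middle _ _).map_smul, Finset.mul_sum]
  · constructor
    · intro a b
      simp only [← Finset.sum_add_distrib, PiLp.add_apply]
      exact Finset.sum_congr rfl fun i _ => Finset.sum_congr rfl fun j _ => by ring
    · intro c a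
      simp only [Finset.mul_sum, PiLp.smul_apply, smul_eq_mul]
      exact Finset.sum_congr rfl fun i _ => Finset.sum_congr rfl fun j _ => by ring
  refine IsLinearMap.eq_of_basisVec (f := fun Z => ∑ i, riem G y (basisVec i) (basisVec j) Z i)
    (g := fun Z => ∑ j', ∑ k, ricci G j' k y * (basisVec j j' * Z k)) ?_ ?_ (fun k => ?_) Z
  · constructor
    · intro a b
      simp [(isLinearMap_curv_right _ _).map_add, Finset.sum_add_distrib]
    · intro c a
      simp [(isLinearMap_curv_right _ _).map_smul, Finset.mul_sum]
  · constructor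
    · intro a b
      simp only [← Finset.sum_add_distrib, PiLp.add_apply]
      exact Finset.sum_congr rfl fun i _ => Finset.sum_congr rfl fun j _ => by ring
    · intro c a
      simp only [Finset.mul_sum, PiLp.smul_apply, smul_eq_mul]
      exact Finset.sum_congr rfl fun i _ => Finset.sum_congr rfl fun j _ => by ring
  simp only [hG.riem_basisVec hy]
  simp [ricci]

/-- A metric whose Ricci tensor is recurrent has no rank one Ricci tensor. -/
theorem IsMetricOn.false_of_recurrent_of_rank_one (hG : IsMetricOn G U) (hy : y ∈ U) {a : Fin n}
    (ha : ricci G a a y ≠ 0) {β : Fin n → Model n → ℝ}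
    (hrank : ∀ᶠ z in nhds y, ∀ i j, ricci G a a z * ricci G i j z = ricci G a i z * ricci G a j z)
    (hrec : ∀ᶠ z in nhds y, ∀ i l, covRicci G a i l z = β l z * ricci G a i z) : False := by
  -- The metric dual of row `a` of the Ricci matrix: `g(v, ·) = Ri(∂_a, ·)`.
  set v : Model n → Model n := fun z =>
    ∑ k, (∑ p, (G z)⁻¹ k p * ricci G a p z) • basisVec k with hvdef
  have hvs : ContDiffAt ℝ ∞ v y := contDiffAt_sum_smul_const fun k _ =>
    ContDiffAt.sum fun p _ => (hG.contDiffAt_inv hy k p).mul (hG.contDiffAt_ricci hy a p)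
  have hvk : ∀ z k, v z k = ∑ p, (G z)⁻¹ k p * ricci G a p z := by
    intro z k
    simp [hvdef, Pi.single_apply]
  have hform : ∀ z ∈ U, ∀ i, form G z (v z) (basisVec i) = ricci G a i z := by
    intro z hz i
    have h : (G z).mulVec ((G z)⁻¹.mulVec (fun p => ricci G a p z)) = fun p => ricci G a p z := by
      rw [Matrix.mulVec_mulVec, Matrix.mul_nonsing_inv _ (hG.isUnit_det hz), Matrix.one_mulVec]
    have h' := congrFun h i
    simp only [Matrix.mulVec, dotProduct] at h'
    rw [form_basisVec_right, ← h']
    exact Finset.sum_congr rfl fun k _ => by rw [hG.symm hz, hvk]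
  have hformX : ∀ z ∈ U, ∀ X, form G z (v z) X = ∑ p, ricci G a p z * X p := by
    intro z hz X
    rw [map_eq_sum_basisVec (form G z (v z))]
    simp [hform z hz, mul_comm]
  have hne : ∀ᶠ z in nhds y, ricci G a a z ≠ 0 :=
    (hG.contDiffAt_ricci hy a a).continuousAt.eventually_ne ha
  have hvne : v y ≠ 0 := by
    intro h
    apply ha
    rw [← hform y hy a, h]
    simp
  have hrecv : ∀ᶠ z in nhds y, ∀ l, ∃ c : ℝ,
      fderiv ℝ v z (basisVec l) = c • v z - conn G z (basisVec l) (v z) := by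
    have hvd : ∀ᶠ z in nhds y, DifferentiableAt ℝ v z :=
      ((hvs.of_le (m := 1) (by simp)).eventually (by simp)).mono
        fun z hz => hz.differentiableAt (by simp)
    filter_upwards [hrank, hrec, hne, hvd, hG.eventually_mem hy] with z h1 h2 h3 h4 hz l
    -- The covariant derivative of `Ri(∂_a, ·)` along `∂_l` is `(∇_l Ri)(∂_a, ·) + Ri(∇_l ∂_a, ·)`.
    -- Recurrence gives the factor `β_l` for the first term; rank one, `Ri_{pi} = Ri_{ap} Ri_{ai} /
    -- Ri_{aa}`, gives the factor for the second.
    refine ⟨β l z + (∑ p, christoffel G p l a z * ricci G a p z) / ricci G a a z, ?_⟩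
    by_contra hcon
    refine (hG.form_pos hz (sub_ne_zero.2 hcon)).ne' ?_
    set W := fderiv ℝ v z (basisVec l) - _ with hW
    have hzero : ∀ i, form G z W (basisVec i) = 0 := by
      intro i
      have hdf := (hG.contDiffAt_form hz).differentiableAt (by simp)
      have e1 : partialD l (ricci G a i) z =
          fderiv ℝ (fun w => form G w (v w) (basisVec i)) z (basisVec l) := by
        have : ricci G a i =ᶠ[nhds z] fun w => form G w (v w) (basisVec i) := by
          filter_upwards [hG.eventually_mem hz] with w hw using (hform w hw i).symm
        rw [partialD, this.fderiv_eq]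
      have e2 : fderiv ℝ (fun w => form G w (v w) (basisVec i)) z (basisVec l) =
          form G z (fderiv ℝ v z (basisVec l)) (basisVec i)
            + fderiv ℝ (form G) z (basisVec l) (v z) (basisVec i) := by
        rw [fderiv_clm_apply (hdf.clm_apply h4) (by fun_prop), fderiv_clm_apply hdf h4]
        simp
      rw [hG.fderiv_form_eq hz, hformX z hz (conn G z _ _)] at e2
      simp only [conn_basisVec] at e2
      have e3 := h2 i l
      simp only [covRicci, Finset.sum_add_distrib] at e3
      have e4 : ∑ p, christoffel G p l a z * ricci G p i z =
          (∑ p, christoffel G p l a z * ricci G a p z) / ricci G a a z * ricci G a i z := by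
        rw [Finset.sum_div, Finset.sum_mul]
        refine Finset.sum_congr rfl fun p _ => ?_
        field_simp
        rw [mul_comm (christoffel G p l a z), mul_right_comm, mul_comm (ricci G p i z), h1 p i]
        ring
      have e5 : ∑ p, ricci G a p z * christoffel G p l i z =
          ∑ p, christoffel G p l i z * ricci G a p z :=
        Finset.sum_congr rfl fun p _ => mul_comm _ _
      simp only [hW, map_sub, map_smul, sub_apply, smul_apply, smul_eq_mul, hform z hz]
      linarith
    rw [map_eq_sum_basisVec (form G z W) W]
    simp [hzero]
  have hrecX : ∀ᶠ z in nhds y, ∀ X, ∃ c : ℝ, fderiv ℝ v z X = c • v z - conn G z X (v z) := by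
    filter_upwards [hrecv] with z hz X
    choose c hc using hz
    refine ⟨∑ l, X l * c l, ?_⟩
    rw [map_eq_sum_basisVec (fderiv ℝ v z), map_eq_sum_basisVec (conn G z)]
    simp [hc, smul_sub, Finset.sum_smul, mul_smul]
  obtain ⟨k, hk⟩ : ∃ k, v y k ≠ 0 := by
    by_contra! h
    exact hvne (by ext k; exact h k)
  set prk : Model n →L[ℝ] ℝ := EuclideanSpace.proj k with hprk
  have hkz : ∀ᶠ z in nhds y, prk (v z) ≠ 0 :=
    (prk.continuous.continuousAt.comp hvs.continuousAt).eventually_ne hk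
  -- The factors `c` come with no regularity in `z`. Dividing the `k`-th component of `∇v` by that
  -- of `v` recovers them as a differentiable one form.
  set θ : Model n → Model n →L[ℝ] ℝ := fun z =>
    (prk (v z))⁻¹ • prk.comp (fderiv ℝ v z + conn G z (v z)) with hθ
  have hdΓ := (hG.contDiffAt_conn hy).differentiableAt (by simp)
  have hdv : DifferentiableAt ℝ v y := hvs.differentiableAt (by simp)
  have hd1 : DifferentiableAt ℝ (fderiv ℝ v) y :=
    (hvs.fderiv_right (m := ∞) (by simp)).differentiableAt (by simp)
  have hθd : DifferentiableAt ℝ θ y :=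
    ((prk.differentiableAt.comp y hdv).inv hk).smul
      ((differentiableAt_const prk).clm_comp (hd1.add (hdΓ.clm_apply hdv)))
  have hθv : ∀ᶠ z in nhds y, ∀ X, fderiv ℝ v z X = θ z X • v z - conn G z X (v z) := by
    filter_upwards [hrecX, hkz, hG.eventually_mem hy] with z h1 h2 hz X
    obtain ⟨c, hc⟩ := h1 X
    have : θ z X = c := by
      simp only [hθ, smul_apply, ContinuousLinearMap.comp_apply, add_apply, hc,
        hG.conn_symm hz (v z) X, sub_add_cancel, map_smul, smul_eq_mul]
      field_simp
    rw [this, hc]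
  have hcurv := fun X Y => curv_of_recurrent hdΓ hvs hθd hθv X Y
  -- Tracing `X ↦ R(X, v)v = dθ(X, v) v` gives `dθ(v, v) = 0`.
  have h0 : ∑ j, ∑ k, ricci G j k y * (v y j * v y k) = 0 := by
    rw [← hG.sum_riem hy]
    simp only [riem, hcurv]
    have : fderiv ℝ θ y (v y) (v y) = ∑ i, v y i * fderiv ℝ θ y (basisVec i) (v y) := by
      conv_lhs => rw [map_eq_sum_basisVec (fderiv ℝ θ y)]
      simp
    have h' : fderiv ℝ θ y (v y) (v y) = ∑ i, v y i * fderiv ℝ θ y (v y) (basisVec i) := by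
      simpa using map_eq_sum_basisVec (fderiv ℝ θ y (v y)) (v y)
    have : ∑ i, ((fderiv ℝ θ y (basisVec i) (v y) - fderiv ℝ θ y (v y) (basisVec i)) • v y) i =
        ∑ i, v y i * fderiv ℝ θ y (basisVec i) (v y)
          - ∑ i, v y i * fderiv ℝ θ y (v y) (basisVec i) := by
      rw [← Finset.sum_sub_distrib]
      refine Finset.sum_congr rfl fun i _ => ?_
      simp only [PiLp.smul_apply, smul_eq_mul]
      ring
    rw [this]
    linarith
  -- By rank one, `Ri_{aa} Ri(v, v) = Ri(∂_a, v)²`, and `Ri(∂_a, v) = g(v, v)`.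
  have h1 : ricci G a a y * ∑ j, ∑ k, ricci G j k y * (v y j * v y k) =
      form G y (v y) (v y) * form G y (v y) (v y) := by
    rw [hformX y hy, Finset.sum_mul_sum, Finset.mul_sum]
    refine Finset.sum_congr rfl fun i _ => ?_
    rw [Finset.mul_sum]
    refine Finset.sum_congr rfl fun j _ => ?_
    rw [← mul_assoc, hrank.self_of_nhds i j]
    ring
  rw [h0, mul_zero] at h1
  have := hG.form_pos hy hvne
  nlinarith

/-- Vanishing of the Ricci tensor does not depend on the coordinates. -/
theorem IsMetricOn.ricci_eq_zero_of_isometry {H : Model n → Matrix (Fin n) (Fin n) ℝ}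
    {V : Set (Model n)} {φ : Model n → Model n} (hG : IsMetricOn G U) (hH : IsMetricOn H V)
    (hy : y ∈ U) (hφy : φ y ∈ V) (hφ : ∀ᶠ z in nhds y, ContDiffAt ℝ ∞ φ z)
    (hform : ∀ᶠ z in nhds y, ∀ X Y,
      form G z X Y = form H (φ z) (fderiv ℝ φ z X) (fderiv ℝ φ z Y))
    (hsurj : ∀ᶠ z in nhds y, Function.Surjective (fderiv ℝ φ z))
    (h0 : ∀ i j, ricci H i j (φ y) = 0) (i j : Fin n) : ricci G i j y = 0 := by
  have hV : ∀ᶠ z in nhds y, φ z ∈ V :=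
    hφ.self_of_nhds.continuousAt.eventually (hH.eventually_mem hφy)
  have hconn : ∀ᶠ z in nhds y, ∀ X Y, fderiv ℝ φ z (conn G z X Y) =
      conn H (φ z) (fderiv ℝ φ z X) (fderiv ℝ φ z Y) + fderiv ℝ (fderiv ℝ φ) z X Y := by
    filter_upwards [hG.eventually_mem hy, hV, hφ, hform.eventually_nhds, hsurj]
      with z hz hφz hs hf hsu
    exact koszul_transform ((hG.contDiffAt_form hz).differentiableAt (by simp))
      ((hH.contDiffAt_form hφz).differentiableAt (by simp)) (hG.form_conn hz) (hH.form_conn hφz)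
      (hH.form_symm hφz) (fun X hX => hH.form_pos hφz hX) hs hf hsu
  have hcurv := curv_transform ((hG.contDiffAt_conn hy).differentiableAt (by simp))
    ((hH.contDiffAt_conn hφy).differentiableAt (by simp)) hφ.self_of_nhds hconn
  have hs := hsurj.self_of_nhds
  have hinj : Function.Injective (fderiv ℝ φ y) :=
    (LinearMap.injective_iff_surjective (f := (fderiv ℝ φ y).toLinearMap)).2 hs
  set e : Model n ≃ₗ[ℝ] Model n :=
    LinearEquiv.ofBijective (fderiv ℝ φ y).toLinearMap ⟨hinj, hs⟩
  have htr (K : Model n → Matrix (Fin n) (Fin n) ℝ) (z Y Z : Model n) :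
      LinearMap.trace ℝ (Model n)
        ((isLinearMap_curv_left (Γ := conn K) (y := z) Y Z).mk' fun X => riem K z X Y Z) =
      ∑ i, riem K z (basisVec i) Y Z i := by
    rw [LinearMap.trace_eq_sum_inner _ (EuclideanSpace.basisFun (Fin n) ℝ)]
    simp [EuclideanSpace.inner_single_left]
  -- `Dφ` conjugates the two endomorphisms `X ↦ R(X, Y)Z`, so their traces agree.
  have hconj (Y Z : Model n) : e.conj
      ((isLinearMap_curv_left (Γ := conn G) (y := y) Y Z).mk' fun X => riem G y X Y Z) =
      (isLinearMap_curv_left (Γ := conn H) (y := φ y) (e Y) (e Z)).mk'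
        fun X => riem H (φ y) X (e Y) (e Z) := by
    ext1 X
    obtain ⟨X, rfl⟩ := e.surjective X
    simp only [LinearEquiv.conj_apply_apply, LinearEquiv.symm_apply_apply, IsLinearMap.mk'_apply]
    exact hcurv X Y Z
  have hric (Y Z : Model n) : ∑ j, ∑ k, ricci G j k y * (Y j * Z k) = 0 := by
    rw [← hG.sum_riem hy, ← htr, ← LinearMap.trace_conj' _ e, hconj, htr, hH.sum_riem hφy]
    simp [h0]
  simpa using hric (basisVec i) (basisVec j)

end RicciForm

/-! ### Pointwise algebra of the two conditions. -/

section Algebra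

variable {n : ℕ} {S : Fin n → Fin n → ℝ}

/-- The symmetric product of a nonzero symmetric form with a nonzero one form is nonzero. -/
theorem eq_zero_of_cyclic_sum_eq_zero {δ : Fin n → ℝ} (hsymm : ∀ i j, S i j = S j i)
    (h : ∀ i j l, δ l * S i j + δ i * S j l + δ j * S l i = 0) (hS : ∃ i j, S i j ≠ 0)
    (a : Fin n) : δ a = 0 := by
  by_contra ha
  obtain ⟨i, j, hij⟩ := hS
  -- With `δ a ≠ 0`, the index triples `(a, a, a)`, `(a, j, a)` and `(i, j, a)` successively kill `S
  -- a a`, row `a` and all of `S`.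
  have h1 : S a a = 0 := by
    have : δ a * S a a = 0 := by linarith [h a a a]
    exact (mul_eq_zero.1 this).resolve_left ha
  have h2 (j : Fin n) : S a j = 0 := by
    have h3 := h a j a
    rw [hsymm j a, h1, mul_zero] at h3
    have : δ a * S a j = 0 := by linarith
    exact (mul_eq_zero.1 this).resolve_left ha
  have h3 := h i j a
  rw [hsymm j a, h2, h2, mul_zero, mul_zero, add_zero, add_zero] at h3
  exact hij ((mul_eq_zero.1 h3).resolve_left ha)

/-- A symmetric form whose covariant derivative is both of recurrent and of pseudo symmetric type
has rank one. -/
theorem rank_one_of_recurrent_of_pseudoSymmetric {α β : Fin n → ℝ} (hsymm : ∀ i j, S i j = S j i)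
    (h : ∀ i j l, β l * S i j = 2 * α l * S i j + α i * S l j + α j * S i l)
    (hS : ∃ i j, S i j ≠ 0) (hα : ∃ a, α a ≠ 0) :
    (∃ a, S a a ≠ 0) ∧ ∀ a i j, S a a * S i j = S a i * S a j := by
  -- The cyclic sum of `h` says that the symmetric product of `β - 4α` with `S` is zero.
  have hδ (a : Fin n) : β a - 4 * α a = 0 := by
    refine eq_zero_of_cyclic_sum_eq_zero (δ := fun a => β a - 4 * α a) hsymm ?_ hS a
    intro i j l
    have h1 := h i j l
    have h2 := h j l i
    have h3 := h l i j
    rw [hsymm l j] at h1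
    rw [hsymm i l, hsymm j i] at h2
    rw [hsymm l j] at h3
    linear_combination h1 + h2 + h3 - α l * hsymm i j + α j * hsymm i l
  -- Subtracting `h` with `i` and `l` exchanged and inserting `β = 4α` leaves three times this
  -- identity.
  have hswap (i j l : Fin n) : α l * S i j = α i * S l j := by
    have h1 := h i j l
    have h2 := h l j i
    rw [hsymm l i] at h2
    have e1 := hδ l
    have e2 := hδ i
    linear_combination (1 / 3) * (h1 - h2) - (1 / 3) * S i j * e1 + (1 / 3) * S l j * e2
  obtain ⟨b, hb⟩ := hα
  have hprod (i j : Fin n) : α b * α b * S i j = α i * α j * S b b := by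
    have e1 := hswap i j b
    have e2 := hswap j b b
    rw [hsymm j b] at e2
    linear_combination α b * e1 + α i * e2
  refine ⟨⟨b, fun hbb => ?_⟩, fun a i j => ?_⟩
  · obtain ⟨i, j, hij⟩ := hS
    have := hprod i j
    rw [hbb, mul_zero] at this
    exact hij ((mul_eq_zero.1 this).resolve_left (mul_ne_zero hb hb))
  -- After multiplication by `α_b⁴`, `hprod` turns both sides into `S_{bb}² α_a² α_i α_j`.
  · have hb4 : (α b * α b) * (α b * α b) ≠ 0 := by positivity
    refine mul_left_cancel₀ hb4 ?_
    linear_combination (α b * α b * S i j) * hprod a a + α a * α a * S b b * hprod i j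
      - (α b * α b * S a j) * hprod a i - α a * α i * S b b * hprod a j

end Algebra

/-! ### Unique continuation for the Ricci tensor by Gronwall's inequality. -/

section LinearSystem

variable {n : ℕ}

/-- Solutions of a linear system of first order equations vanish near their zeros. -/
theorem eventually_eq_zero_of_partialD_le {ι : Type*} [Fintype ι] {f : ι → Model n → ℝ}
    {y : Model n} {K : ℝ} (hf : ∀ᶠ z in nhds y, ∀ a, DifferentiableAt ℝ (f a) z)
    (hK : ∀ᶠ z in nhds y, ∀ a l, |partialD l (f a) z| ≤ K * ‖fun b => f b z‖)
    (h0 : ∀ a, f a y = 0) : ∀ᶠ z in nhds y, ∀ a, f a z = 0 := by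
  obtain ⟨r, hr, hball⟩ := Metric.eventually_nhds_iff_ball.1 (hf.and hK)
  refine Metric.eventually_nhds_iff_ball.2 ⟨r, hr, fun z hz => ?_⟩
  set w := z - y with hw
  have hmem : ∀ t ∈ Set.Icc (0 : ℝ) 1, y + t • w ∈ Metric.ball y r := by
    intro t ht
    rw [Metric.mem_ball, dist_eq_norm] at hz ⊢
    rw [add_sub_cancel_left, norm_smul, Real.norm_of_nonneg ht.1]
    exact (mul_le_of_le_one_left (norm_nonneg _) ht.2).trans_lt hz
  have hderiv : ∀ t ∈ Set.Icc (0 : ℝ) 1, HasDerivAt (fun t : ℝ => fun a => f a (y + t • w))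
      (fun a => fderiv ℝ (f a) (y + t • w) w) t := by
    intro t ht
    rw [hasDerivAt_pi]
    intro a
    have h1 : HasDerivAt (fun t : ℝ => y + t • w) w t := by
      simpa using ((hasDerivAt_id t).smul_const w).const_add y
    exact ((hball _ (hmem t ht)).1 a).hasFDerivAt.comp_hasDerivAt t h1
  -- Gronwall along the segment `y + t w`; the constant carries the `ℓ¹` norm of `w` because `hK`
  -- bounds each partial derivative separately.
  have key := eq_zero_of_abs_deriv_le_mul_abs_self_of_eq_zero_right
    (f := fun t : ℝ => fun a => f a (y + t • w))
    (f' := fun t a => fderiv ℝ (f a) (y + t • w) w) (K := (∑ l, |w l|) * K) (a := 0) (b := 1)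
    (fun t ht => (hderiv t ht).continuousAt.continuousWithinAt)
    (fun t ht => (hderiv t ⟨ht.1, ht.2.le⟩).hasDerivWithinAt) (by ext a; simp [h0]) ?_ 1 (by simp)
  · intro a
    simpa [hw] using congrFun key a
  · intro t ht
    have hb := (hball _ (hmem t ⟨ht.1, ht.2.le⟩)).2
    set N := ‖fun b => f b (y + t • w)‖ with hN
    -- No sign is assumed for `K`, so the componentwise bound controls the sup norm only when `ι` is
    -- nonempty.
    by_cases hι : Nonempty ι
    · refine (pi_norm_le_iff_of_nonempty _).2 fun a => ?_
      rw [map_eq_sum_basisVec (fderiv ℝ (f a) (y + t • w)) w, Finset.sum_mul, Finset.sum_mul]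
      refine (norm_sum_le _ _).trans (Finset.sum_le_sum fun l _ => ?_)
      rw [smul_eq_mul, Real.norm_eq_abs, abs_mul, mul_assoc]
      exact mul_le_mul_of_nonneg_left (hb a l) (abs_nonneg _)
    · have : IsEmpty ι := not_nonempty_iff.1 hι
      simp [hN, Subsingleton.elim (fun a => fderiv ℝ (f a) (y + t • w) w) 0,
        Subsingleton.elim (fun b => f b (y + t • w)) 0]

/-- Solved for `∂_l Ri_{ij}`, the equation is linear in the components of `Ri`, with coefficients
built from `α` and `Γ` and hence locally bounded. -/
theorem IsMetricOn.eventually_ricci_eq_zero {G : Model n → Matrix (Fin n) (Fin n) ℝ}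
    {U : Set (Model n)} (hG : IsMetricOn G U) {y : Model n} (hy : y ∈ U)
    {α : Fin n → Model n → ℝ} (hα : ∀ i, ContinuousAt (α i) y)
    (h : ∀ z ∈ U, ∀ i j l, covRicci G i j l z =
      2 * α l z * ricci G i j z + α i z * ricci G l j z + α j z * ricci G i l z)
    (h0 : ∀ i j, ricci G i j y = 0) : ∀ᶠ z in nhds y, ∀ i j, ricci G i j z = 0 := by
  -- The summand `1` makes the bounds strict at `y`, so that they persist nearby.
  set A : ℝ := ∑ i, |α i y| + 1 with hA
  set C : ℝ := ∑ k, ∑ i, ∑ j, |christoffel G k i j y| + 1 with hC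
  have hαb : ∀ᶠ z in nhds y, ∀ i, |α i z| ≤ A := by
    rw [Filter.eventually_all]
    intro i
    have h1 : |α i y| < A := by
      have := Finset.single_le_sum (f := fun i => |α i y|) (fun i _ => abs_nonneg _)
        (Finset.mem_univ i)
      linarith
    exact ((hα i).abs.eventually_lt continuousAt_const h1).mono fun z hz => hz.le
  have hΓb : ∀ᶠ z in nhds y, ∀ k i j, |christoffel G k i j z| ≤ C := by
    simp only [Filter.eventually_all]
    intro k i j
    have h1 : |christoffel G k i j y| < C := by
      have e1 := Finset.single_le_sum (f := fun j => |christoffel G k i j y|)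
        (fun i _ => abs_nonneg _) (Finset.mem_univ j)
      have e2 := Finset.single_le_sum (f := fun i => ∑ j, |christoffel G k i j y|)
        (fun i _ => Finset.sum_nonneg fun _ _ => abs_nonneg _) (Finset.mem_univ i)
      have e3 := Finset.single_le_sum (f := fun k => ∑ i, ∑ j, |christoffel G k i j y|)
        (fun i _ => Finset.sum_nonneg fun _ _ => Finset.sum_nonneg fun _ _ => abs_nonneg _)
        (Finset.mem_univ k)
      linarith
    exact ((hG.contDiffAt_christoffel hy k i j).continuousAt.abs.eventually_lt
      continuousAt_const h1).mono fun z hz => hz.le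
  -- In `K`, `4 * A` bounds the coefficients `2α_l, α_i, α_j`, and `n * (2 * C)` the `n` pairs of
  -- Christoffel terms.
  have key := eventually_eq_zero_of_partialD_le (y := y)
    (f := fun a : Fin n × Fin n => ricci G a.1 a.2) (K := 4 * A + n * (2 * C)) ?_ ?_
    (fun a => h0 a.1 a.2)
  · filter_upwards [key] with z hz i j using hz (i, j)
  · filter_upwards [hG.eventually_mem hy] with z hz a
    exact (hG.contDiffAt_ricci hz _ _).differentiableAt (by simp)
  · filter_upwards [hαb, hΓb, hG.eventually_mem hy] with z h1 h2 hz
    rintro ⟨i, j⟩ l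
    set N := ‖fun b : Fin n × Fin n => ricci G b.1 b.2 z‖ with hN
    have hS (p q : Fin n) : |ricci G p q z| ≤ N :=
      norm_le_pi_norm (fun b : Fin n × Fin n => ricci G b.1 b.2 z) (p, q)
    have hmul {x B : ℝ} (hx : |x| ≤ B) (p q : Fin n) : |x * ricci G p q z| ≤ B * N := by
      rw [abs_mul]
      exact mul_le_mul hx (hS p q) (abs_nonneg _) ((abs_nonneg _).trans hx)
    have e := h z hz i j l
    rw [covRicci, sub_eq_iff_eq_add] at e
    simp only [e]
    have b1 := hmul (h1 l) i j
    have b2 := hmul (h1 i) l j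
    have b3 := hmul (h1 j) i l
    have b4 : |∑ p, (christoffel G p l i z * ricci G p j z
        + christoffel G p l j z * ricci G i p z)| ≤ n * (2 * C) * N := by
      refine (Finset.abs_sum_le_sum_abs _ _).trans ?_
      have : ∑ _p : Fin n, (C * N + C * N) = n * (2 * C) * N := by
        simp
        ring
      rw [← this]
      exact Finset.sum_le_sum fun p _ =>
        (abs_add_le _ _).trans (add_le_add (hmul (h2 _ _ _) _ _) (hmul (h2 _ _ _) _ _))
    rw [abs_le] at *
    constructor <;> linarith [b1.1, b1.2, b2.1, b2.2, b3.1, b3.2, b4.1, b4.2]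

end LinearSystem

/-! ### Smoothness of the components in a chart. -/

section Charts

variable {n : ℕ} {M : Type*} [TopologicalSpace M] [ChartedSpace (Model n) M]
  [IsManifold (𝓡 n) ∞ M]

/-- Near `y` this section is the tangent map of `e.symm` applied to a constant vector field. -/
theorem contMDiffAt_coordVec {e : OpenPartialHomeomorph M (Model n)}
    (he : e ∈ atlas (Model n) M) {y : Model n} (hy : y ∈ e.target) (i : Fin n) :
    ContMDiffAt (𝓡 n) ((𝓡 n).prod 𝓘(ℝ, Model n)) ∞
      (fun z => TotalSpace.mk' (Model n) (E := fun x : M => TangentSpace (𝓡 n) x)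
        (e.symm z) (coordVec e i z)) y := by
  have h := contMDiffOn_symm_of_mem_maximalAtlas (I := 𝓡 n) (n := ∞)
    (IsManifold.subset_maximalAtlas he)
  have h1 := h.contMDiffOn_tangentMapWithin (m := ∞) (by simp) e.open_target.uniqueMDiffOn
  have h2 : ContMDiff (𝓡 n) ((𝓡 n).prod 𝓘(ℝ, Model n)) ∞
      (fun z : Model n => TotalSpace.mk' (Model n) (E := fun x : Model n => TangentSpace (𝓡 n) x)
        z (EuclideanSpace.single i (1 : ℝ) : Model n)) := by
    intro z
    exact contMDiffAt_vectorSpace_iff_contDiffAt.2 contDiffAt_const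
  have h3 := (h1.comp h2.contMDiffOn (s := e.target) (fun z hz => hz)).contMDiffAt
    (e.open_target.mem_nhds hy)
  refine h3.congr_of_eventuallyEq ?_
  filter_upwards [e.open_target.mem_nhds hy] with z hz
  simp only [Function.comp, tangentMapWithin, coordVec]
  rw [mfderivWithin_of_isOpen e.open_target hz]

theorem contDiffAt_metricCoeff (g : Metric n M) {e : OpenPartialHomeomorph M (Model n)}
    (he : e ∈ atlas (Model n) M) {y : Model n} (hy : y ∈ e.target) (i j : Fin n) :
    ContDiffAt ℝ ∞ (fun z => Metric.coeff g e z i j) y := by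
  have hs : ContMDiffAt (𝓡 n) (𝓡 n) ∞ e.symm y :=
    (contMDiffOn_symm_of_mem_maximalAtlas (I := 𝓡 n) (n := ∞)
    (IsManifold.subset_maximalAtlas he)).contMDiffAt (e.open_target.mem_nhds hy)
  have := ContMDiffAt.clm_bundle_apply₂ (E₃ := Bundle.Trivial M ℝ) (F₃ := ℝ)
    (ψ := fun z => g.inner (e.symm z))
    (g.contMDiff.contMDiffAt.comp y hs) (contMDiffAt_coordVec he hy i)
    (contMDiffAt_coordVec he hy j)
  simp only [contMDiffAt_totalSpace] at this
  exact contMDiffAt_iff_contDiffAt.1 this.2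

theorem contDiffAt_oneFormCoeff (α : OneForm n M) {e : OpenPartialHomeomorph M (Model n)}
    (he : e ∈ atlas (Model n) M) {y : Model n} (hy : y ∈ e.target) (i : Fin n) :
    ContDiffAt ℝ ∞ (OneForm.coeff α e i) y := by
  have hs : ContMDiffAt (𝓡 n) (𝓡 n) ∞ e.symm y :=
    (contMDiffOn_symm_of_mem_maximalAtlas (I := 𝓡 n) (n := ∞)
    (IsManifold.subset_maximalAtlas he)).contMDiffAt (e.open_target.mem_nhds hy)
  have := ContMDiffAt.clm_bundle_apply (E₂ := Bundle.Trivial M ℝ) (F₂ := ℝ)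
    (ϕ := fun z => α (e.symm z))
    (α.contMDiff.contMDiffAt.comp y hs) (contMDiffAt_coordVec he hy i)
  simp only [contMDiffAt_totalSpace] at this
  exact contMDiffAt_iff_contDiffAt.1 this.2

end Charts

/-! ### Change of charts and the zero set of the Ricci tensor. -/

section Charts

variable {n : ℕ} {M : Type*} [TopologicalSpace M] [ChartedSpace (Model n) M]
  [IsManifold (𝓡 n) ∞ M] {e e' : OpenPartialHomeomorph M (Model n)} {y : Model n}

/-- The differential of the inverse of a chart. -/
abbrev symmDeriv (e : OpenPartialHomeomorph M (Model n)) (y : Model n) :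
    Model n →L[ℝ] TangentSpace (𝓡 n) (e.symm y) :=
  mfderiv (𝓡 n) (𝓡 n) e.symm y

theorem symmDeriv_bijective (he : e ∈ atlas (Model n) M) (hy : y ∈ e.target) :
    Function.Bijective (symmDeriv (n := n) e y) :=
  (mdifferentiable_of_mem_atlas (I := 𝓡 n) he).symm.mfderiv_bijective hy

theorem form_coeff (g : Metric n M) (X Y : Model n) :
    form (Metric.coeff g e) y X Y =
      g.inner (e.symm y) (symmDeriv e y X) (symmDeriv e y Y) := by
  rw [map_eq_sum_basisVec (symmDeriv e y) X, map_eq_sum_basisVec (symmDeriv e y) Y, form_apply]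
  simp only [map_sum, map_smul, sum_apply, smul_apply, smul_eq_mul]
  rw [Finset.sum_comm]
  refine Finset.sum_congr rfl fun j _ => ?_
  rw [Finset.mul_sum]
  refine Finset.sum_congr rfl fun i _ => ?_
  change g.inner _ (symmDeriv e y (basisVec i)) (symmDeriv e y (basisVec j)) * _ = _
  ring

theorem isMetricOn_coeff (g : Metric n M) (he : e ∈ atlas (Model n) M) :
    IsMetricOn (Metric.coeff g e) e.target where
  isOpen := e.open_target
  contDiffAt y hy i j := contDiffAt_metricCoeff g he hy i j
  posDef y hy := by
    refine Matrix.PosDef.of_dotProduct_mulVec_pos ?_ fun x hx => ?_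
    · ext i j
      simp [Metric.coeff, g.symm _ (coordVec e i y)]
    · have hne : symmDeriv (n := n) e y (WithLp.toLp 2 x) ≠ 0 := by
        intro h
        have := (symmDeriv_bijective he hy).1 (h.trans (map_zero _).symm)
        exact hx (congrArg WithLp.ofLp this)
      have := g.pos _ _ hne
      rw [← form_coeff, form_self_apply] at this
      exact this

theorem exists_oneFormCoeff_ne_zero (α : OneForm n M) (he : e ∈ atlas (Model n) M)
    (hy : y ∈ e.target) (h : α (e.symm y) ≠ 0) : ∃ i, OneForm.coeff α e i y ≠ 0 := by
  by_contra! hc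
  refine h (ContinuousLinearMap.ext fun v => ?_)
  obtain ⟨X, rfl⟩ := (symmDeriv_bijective he hy).2 v
  rw [map_eq_sum_basisVec (symmDeriv e y) X]
  simp only [map_sum, map_smul]
  exact Finset.sum_congr rfl fun i _ => congrArg (X i • ·) (hc i)

/-- Every tangent space unfolds to `Model n`, so vectors can be kept fixed while the base point is
rewritten. -/
theorem inner_congr (g : Metric n M) {p q : M} (h : p = q) (v w : Model n) :
    g.inner p v w = g.inner q v w := by rw [h]

/-- Properties of the transition map `e' ∘ e.symm`. -/
theorem transition_properties (g : Metric n M) (he : e ∈ atlas (Model n) M)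
    (he' : e' ∈ atlas (Model n) M) (hy : y ∈ e.target) (hy' : e.symm y ∈ e'.source) :
    ContDiffAt ℝ ∞ (fun z => e' (e.symm z)) y ∧
    (∀ X Y, form (Metric.coeff g e) y X Y = form (Metric.coeff g e') (e' (e.symm y))
      (fderiv ℝ (fun z => e' (e.symm z)) y X) (fderiv ℝ (fun z => e' (e.symm z)) y Y)) ∧
    Function.Surjective (fderiv ℝ (fun z => e' (e.symm z)) y) := by
  set φ : Model n → Model n := fun z => e' (e.symm z) with hφ
  have hφy : φ y ∈ e'.target := e'.map_source hy'
  have hs : ContMDiffAt (𝓡 n) (𝓡 n) ∞ e.symm y :=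
    (contMDiffOn_symm_of_mem_maximalAtlas (I := 𝓡 n) (n := ∞)
    (IsManifold.subset_maximalAtlas he)).contMDiffAt (e.open_target.mem_nhds hy)
  have hs' : ContMDiffAt (𝓡 n) (𝓡 n) ∞ e' (e.symm y) :=
    (contMDiffOn_of_mem_maximalAtlas (I := 𝓡 n) (n := ∞)
    (IsManifold.subset_maximalAtlas he')).contMDiffAt (e'.open_source.mem_nhds hy')
  have hcd : ContDiffAt ℝ ∞ φ y := contMDiffAt_iff_contDiffAt.1 (hs'.comp y hs)
  have hm : MDifferentiableAt (𝓡 n) (𝓡 n) φ y :=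
    (hcd.differentiableAt (by simp)).mdifferentiableAt
  have hm' := (mdifferentiable_of_mem_atlas (I := 𝓡 n) he').mdifferentiableAt_symm hφy
  have hev : (e'.symm ∘ φ) =ᶠ[nhds y] e.symm := by
    filter_upwards [hs.continuousAt.eventually (e'.open_source.mem_nhds hy')] with z hz
    exact e'.left_inv hz
  have hpt : e'.symm (φ y) = e.symm y := e'.left_inv hy'
  -- The chain rule for `e'.symm ∘ φ = e.symm` near `y`. It is stated in `Model n` because the two
  -- tangent spaces have different base points syntactically.
  have hchain (X : Model n) : (symmDeriv e' (φ y) (fderiv ℝ φ y X) : Model n) =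
      (symmDeriv e y X : Model n) := by
    have h1 : (mfderiv (𝓡 n) (𝓡 n) (e'.symm ∘ φ) y : Model n →L[ℝ] Model n) =
      mfderiv (𝓡 n) (𝓡 n) e.symm y := hev.mfderiv_eq
    have h2 := mfderiv_comp y hm' hm
    have h3 := (congrArg (fun L : Model n →L[ℝ] Model n => L X) h1).symm
    refine Eq.trans ?_ h3.symm
    have h4 := congrArg (fun L : Model n →L[ℝ] Model n => L X) h2
    refine Eq.trans ?_ h4.symm
    have h5 : mfderiv (𝓡 n) (𝓡 n) φ y = fderiv ℝ φ y := mfderiv_eq_fderiv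
    exact congrArg (fun L : Model n →L[ℝ] Model n => symmDeriv e' (φ y) (L X)) h5.symm
  refine ⟨hcd, fun X Y => ?_, ?_⟩
  · rw [form_coeff, form_coeff]
    refine (inner_congr g hpt.symm _ _).trans ?_
    have := congrArg₂ (fun v w : Model n => g.inner (e'.symm (φ y)) v w) (hchain X) (hchain Y)
    exact this.symm
  · intro W
    obtain ⟨X, hX⟩ := (symmDeriv_bijective he hy).2 (symmDeriv e' (φ y) W : Model n)
    exact ⟨X, (symmDeriv_bijective he' hφy).1 ((hchain X).trans hX)⟩

/-- Vanishing of the Ricci tensor at a point does not depend on the chart. -/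
theorem ricci_eq_zero_of_ricci_eq_zero (g : Metric n M) (he : e ∈ atlas (Model n) M)
    (he' : e' ∈ atlas (Model n) M) {x : M} (hx : x ∈ e.source) (hx' : x ∈ e'.source)
    (h : ∀ i j, ricci (Metric.coeff g e') i j (e' x) = 0) (i j : Fin n) :
    ricci (Metric.coeff g e) i j (e x) = 0 := by
  have hy := e.map_source hx
  have hxs : e.symm (e x) = x := e.left_inv hx
  have hev : ∀ᶠ z in nhds (e x), z ∈ e.target ∧ e.symm z ∈ e'.source :=
    (Filter.eventually_mem_set.2 (e.open_target.mem_nhds hy)).and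
      ((e.continuousAt_symm hy).eventually (e'.open_source.mem_nhds (by rwa [hxs])))
  have hp := hev.mono fun z hz => transition_properties g he he' hz.1 hz.2
  refine (isMetricOn_coeff g he).ricci_eq_zero_of_isometry (isMetricOn_coeff g he') hy
    (φ := fun z => e' (e.symm z)) (by rw [hxs]; exact e'.map_source hx')
    (hp.mono fun z hz => hz.1) (hp.mono fun z hz => hz.2.1) (hp.mono fun z hz => hz.2.2) ?_ i j
  simpa only [hxs] using h

/-- The Ricci tensor of a connected pseudo Ricci symmetric manifold vanishes nowhere or
everywhere. -/
theorem exists_ricci_ne_zero [ConnectedSpace M] (g : Metric n M) (hRi : RicciNonzero g)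
    {α : OneForm n M} (hα : ∀ e ∈ atlas (Model n) M, ∀ y ∈ e.target, ∀ i j l,
      covRicci (Metric.coeff g e) i j l y =
        2 * OneForm.coeff α e l y * ricci (Metric.coeff g e) i j y
          + OneForm.coeff α e i y * ricci (Metric.coeff g e) l j y
          + OneForm.coeff α e j y * ricci (Metric.coeff g e) i l y)
    (he : e ∈ atlas (Model n) M) (hy : y ∈ e.target) :
    ∃ i j, ricci (Metric.coeff g e) i j y ≠ 0 := by
  -- The zero set of `Ri`: open by unique continuation, closed by continuity. Its definition uses a
  -- different chart at each point, so both arguments go through `hmem`.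
  set Z : Set M := {x | ∀ i j, ricci (Metric.coeff g (chartAt (Model n) x)) i j
    (chartAt (Model n) x x) = 0} with hZ
  have hmem {x : M} {e : OpenPartialHomeomorph M (Model n)} (he : e ∈ atlas (Model n) M)
      (hx : x ∈ e.source) : x ∈ Z ↔ ∀ i j, ricci (Metric.coeff g e) i j (e x) = 0 :=
    ⟨fun h => ricci_eq_zero_of_ricci_eq_zero g he (chart_mem_atlas _ x) hx
      (mem_chart_source _ x) h, fun h => ricci_eq_zero_of_ricci_eq_zero g (chart_mem_atlas _ x) he
      (mem_chart_source _ x) hx h⟩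
  have hopen : IsOpen Z := by
    rw [isOpen_iff_mem_nhds]
    intro x hx
    have hc := chart_mem_atlas (Model n) x
    have hs := mem_chart_source (Model n) x
    have ht := mem_chart_target (Model n) x
    have h1 := (isMetricOn_coeff g hc).eventually_ricci_eq_zero ht
      (fun i => (contDiffAt_oneFormCoeff α hc ht i).continuousAt) (hα _ hc) hx
    filter_upwards [((chartAt (Model n) x).continuousAt hs).eventually h1,
      (chartAt (Model n) x).open_source.mem_nhds hs] with z hz hzs
    exact (hmem hc hzs).2 hz
  have hclosed : IsClosed Z := by
    rw [← isOpen_compl_iff, isOpen_iff_mem_nhds]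
    intro x hx
    have hc := chart_mem_atlas (Model n) x
    have hs := mem_chart_source (Model n) x
    have ht := mem_chart_target (Model n) x
    have hx' : ∃ i j, ricci (Metric.coeff g (chartAt (Model n) x)) i j
        (chartAt (Model n) x x) ≠ 0 := by
      by_contra! h
      exact hx h
    obtain ⟨i, j, hij⟩ := hx'
    have h1 := ((isMetricOn_coeff g hc).contDiffAt_ricci ht i j).continuousAt.eventually_ne hij
    filter_upwards [((chartAt (Model n) x).continuousAt hs).eventually h1,
      (chartAt (Model n) x).open_source.mem_nhds hs] with z hz hzs hzZ
    exact hz ((hmem hc hzs).1 hzZ i j)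
  obtain ⟨e₀, he₀, y₀, hy₀, i, j, hij⟩ := hRi
  have hempty : Z = ∅ := by
    refine (isClopen_iff.1 ⟨hclosed, hopen⟩).resolve_right fun h => ?_
    have h1 : e₀.symm y₀ ∈ Z := h ▸ Set.mem_univ _
    have := (hmem he₀ (e₀.map_target hy₀)).1 h1 i j
    rw [e₀.right_inv hy₀] at this
    exact hij this
  by_contra! h
  have : e.symm y ∈ Z := (hmem he (e.map_target hy)).2 (by rwa [e.right_inv hy])
  rw [hempty] at this
  exact this

end Charts

end RicciClasses

end

theorem mainTheorem3 (n : ℕ) (M : Type*) [TopologicalSpace M] [ConnectedSpace M]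
    [ChartedSpace (RicciClasses.Model n) M] [IsManifold (𝓡 n) ∞ M]
    (g : RicciClasses.Metric n M) (hRi : RicciClasses.RicciNonzero g) :
    ¬ (RicciClasses.RicciRecurrent g ∧ RicciClasses.PseudoRicciSymmetric g) ∧
      (RicciClasses.RicciParallel g → ¬ RicciClasses.PseudoRicciSymmetric g) := by
  have hpoint : ∀ α : RicciClasses.OneForm n M, α ≠ 0 →
      ∃ e ∈ atlas (RicciClasses.Model n) M, ∃ y ∈ e.target,
        ∃ i, RicciClasses.OneForm.coeff α e i y ≠ 0 := by
    intro α hα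
    obtain ⟨x, hx⟩ : ∃ x, α x ≠ 0 := by
      by_contra! h
      exact hα (ContMDiffSection.ext h)
    refine ⟨_, chart_mem_atlas (RicciClasses.Model n) x, _,
      mem_chart_target (RicciClasses.Model n) x,
      RicciClasses.exists_oneFormCoeff_ne_zero α (chart_mem_atlas _ x) (mem_chart_target _ x) ?_⟩
    rwa [(chartAt (RicciClasses.Model n) x).left_inv (mem_chart_source _ x)]
  constructor
  · rintro ⟨⟨β, -, hβ⟩, α, hα0, hα⟩
    obtain ⟨e, he, y, hy, a, ha⟩ := hpoint α hα0
    have hG := RicciClasses.isMetricOn_coeff g he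
    -- Rank one is needed on a neighbourhood, since the argument that follows differentiates; it
    -- holds wherever `α_a ≠ 0`.
    have hrank : ∀ᶠ z in nhds y,
        (∃ a, RicciClasses.ricci (RicciClasses.Metric.coeff g e) a a z ≠ 0) ∧
        ∀ a i j, RicciClasses.ricci (RicciClasses.Metric.coeff g e) a a z
          * RicciClasses.ricci (RicciClasses.Metric.coeff g e) i j z =
          RicciClasses.ricci (RicciClasses.Metric.coeff g e) a i z
          * RicciClasses.ricci (RicciClasses.Metric.coeff g e) a j z := by
      filter_upwards [hG.eventually_mem hy,
        (RicciClasses.contDiffAt_oneFormCoeff α he hy a).continuousAt.eventually_ne ha]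
        with z hz hza
      refine RicciClasses.rank_one_of_recurrent_of_pseudoSymmetric
        (α := fun i => RicciClasses.OneForm.coeff α e i z)
        (β := fun i => RicciClasses.OneForm.coeff β e i z) (hG.ricci_symm hz)
        (fun i j l => ?_) (RicciClasses.exists_ricci_ne_zero g hRi hα he hz) ⟨a, hza⟩
      rw [← hβ e he z hz, hα e he z hz]
    obtain ⟨b, hb⟩ := hrank.self_of_nhds.1
    refine hG.false_of_recurrent_of_rank_one hy hb (β := fun l => RicciClasses.OneForm.coeff β e l)
      (hrank.mono fun z hz => hz.2 b) ?_
    filter_upwards [hG.eventually_mem hy] with z hz i l using hβ e he z hz b i l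
  · rintro hpar ⟨α, hα0, hα⟩
    obtain ⟨e, he, y, hy, a, ha⟩ := hpoint α hα0
    have hs := (RicciClasses.isMetricOn_coeff g he).ricci_symm hy
    refine ha (RicciClasses.eq_zero_of_cyclic_sum_eq_zero
      (δ := fun i => RicciClasses.OneForm.coeff α e i y) hs (fun i j l => ?_)
      (RicciClasses.exists_ricci_ne_zero g hRi hα he hy) a)
    have h1 := hα e he y hy i j l
    have h2 := hα e he y hy j l i
    have h3 := hα e he y hy l i j
    rw [hpar e he y hy] at h1 h2 h3
    -- Each product `α_l Ri_{ij}` occurs four times in the cyclic sum, up to the symmetry of `Ri`.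
    linear_combination -(1 / 4) * (h1 + h2 + h3) + (1 / 2) * α.coeff e l y * hs i j
      + (1 / 2) * α.coeff e i y * hs j l + (1 / 2) * α.coeff e j y * hs l i
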